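/- Let \(\eta(z)=q^{1/24}\prod_{n\ge 1}(1-q^n)\), \(q=e^{2\pi i z}\), be the Dedekind eta function. Let \(p>3\) be a prime and put \[ h=\begin{cases}1,& p\equiv 11,23 \pmod{24},\\ 2,& p\equiv 5 \pmod{24},\\ 3,& p\equiv 7,19 \pmod{24},\\ 4,& p\equiv 17 \pmod{24},\\ 6,& p\equiv 13\pmod{24},\\ 12,& p\equiv 1\pmod{24}.\end{cases} \] Let \(k\) be a positive integer with \(k=hk'\) for an integer \(k'\), and let \(d\) be the integer with \(p-1=2hd\). Let \(c\) be the smallest non-negative integer with \(c\equiv \frac{k'h}{12}\pmod d\), where rational numbers \(x,y\) are congruent modulo \(d\) if the numerator of \(x-y\) in lowest terms is divisible by \(d\). Consider the set of all \(\eta\)-quotients \(\eta(z)^{r_1}\eta(pz)^{r_p}\) with \(r_1,r_p\in\mathbb Z\) that are cusp forms of weight \(k\) for \(\Gamma_1(p)\), that is, lie in \(S_k(\Gamma_1(p))\). This set is finite, and: \begin{enumerate} \item if \(c=\frac{k(p+1)}{12}-\left\lfloor\frac{k(p+1)}{12d}\right\rfloor d\), it has exactly \(\frac{k(p+1)}{12d}-1\)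 elements; \item if \(c<\frac{k(p+1)}{12}-\left\lfloor\frac{k(p+1)}{12d}\right\rfloor d\), it has exactly \(\left\lceil\frac{k(p+1)}{12d}\right\rceil\) elements; \item if \(c>\frac{k(p+1)}{12}-\left\lfloor\frac{k(p+1)}{12d}\right\rfloor d\), it has exactly \(\left\lfloor\frac{k(p+1)}{12d}\right\rfloor\) elements. \end{enumerate} -/

import Mathlib

noncomputable section

/-- The eta-quotient of level `N` with exponents `r δ ∈ ℤ`, as a function on the upper half-plane:
`z ↦ ∏_{δ ∣ N} η(δ z) ^ (r δ)`. Here `ModularForm.eta` is the Dedekind eta function. Only the values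
of `r` at the divisors of `N` matter. -/
def etaQuotient (N : ℕ) (r : ℕ → ℤ) (z : UpperHalfPlane) : ℂ :=
  ∏ δ ∈ N.divisors, ModularForm.eta ((δ : ℂ) * (z : ℂ)) ^ (r δ)

/-- The set of eta-quotients of level `N` that lie in `S_k(Γ₁(N))`: the weight `k` cusp forms for
`Γ₁(N)` whose underlying function is an eta-quotient of level `N`. -/
def etaQuotientCuspForms (N : ℕ) (k : ℤ) :
    Set (CuspForm ((CongruenceSubgroup.Gamma1 N).map (Matrix.SpecialLinearGroup.mapGL ℝ)) k) :=
  {f | ∃ r : ℕ → ℤ, ∀ z : UpperHalfPlane, f z = etaQuotient N r z}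

/-- The divisor `h` that the weight of an eta-quotient of prime level `p` needs to have; it depends
on the residue class of `p` modulo 24. The last line is never reached for a prime `p`. -/
def etaWeightDivisor (p : ℕ) : ℕ :=
  match p % 24 with
  | 11 => 1
  | 23 => 1
  | 2 => 4
  | 17 => 4
  | 3 => 3
  | 7 => 3
  | 19 => 3
  | 5 => 2
  | 13 => 6
  | 1 => 12
  | _ => 1

/-- Congruence of rational numbers modulo `d`: the difference, written in lowest terms, has a
numerator divisible by `d` (and so, for `d ≠ 0`, a denominator prime to `d`). -/
def RatModEq (d : ℕ) (x y : ℚ) : Prop :=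
  (d : ℤ) ∣ (x - y).num

end

/-!
An eta-quotient of prime level `p` is `η(z) ^ r * η(p z) ^ s` (`etaPair`). It has no zeros in the
upper half-plane, and it is a cusp form of weight `k` for `Γ₁(p)` exactly when `r + s = 2 k`, the
orders `(r + p s) / 24` and `(p r + s) / 24` at the two cusps of `Γ₀(p)` are integers, and both are
positive (`exists_cuspForm_iff`).

Necessity is tested on the two elements `z ↦ z + 1` and `z ↦ z / (p z + 1)` of `Γ₁(p)`, under
which the transformation of `η` is explicit, and on the growth at the cusps `∞` and `0`.

For sufficiency, invariance under all of `Γ₁(p)` is needed. As `p ^ 2 ≡ 1` modulo `24`, the two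
elements above generate the modular group modulo `24`, so it is enough to treat `Γ₁(p) ∩ Γ(24)`.
There the multiplier of `η` is the Jacobi symbol `(c / d)` (`eta_smul_of_modEq_one`), the multiplier
of `η(p z)` is `((c / p) / d)`, and they agree since `(p / d) = (d / p) = 1` by reciprocity. As
`r + s` is even, the multiplier of the product is `1` (`Gamma1_le_slashStabilizer`).
The multiplier on `Γ(24)` comes from the classical formula modulo `24`, proved by the Euclidean
algorithm on the lower row of the matrix (`exists_isEtaExponent`): adding one entry of a
non-negative lower row to the other multiplies `η` by an explicit root of unity, and keeping the
lower row non-negative keeps all square roots on their principal branch.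

At a cusp only absolute values matter, and `‖η‖` transforms under the whole modular group because
the discriminant `η ^ 24` is a modular form.

For the count, let `h` be the weight divisor, `e = 12 / h` and `M = k (p + 1) / 12`. The order
`x = (r + p s) / 24` at `∞` determines the form and runs over the integers with `0 < x < M` and
`e x ≡ k'` modulo `d`. Since `e` is prime to `d` this is the residue class of `c`, and the elements
of a residue class in an interval are counted by `ncard_residue_class_Ioo`. Finally `e M ≡ 2 k'`
modulo `d`, so that `c ≡ M` forces `d ∣ k'`, hence `c = 0` and `d ∣ M`, which gives the first case.
-/

/-! ### The Dedekind eta function under the unipotent generators -/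

noncomputable section

open ModularForm Complex
open scoped Real

/-- The primitive `24`-th root of unity `exp (2πi / 24)`, by which `η` is multiplied under
`z ↦ z + 1`. -/
def zeta24 : ℂ := cexp (2 * π * I / 24)

lemma zeta24_ne_zero : zeta24 ≠ 0 := exp_ne_zero _

lemma isPrimitiveRoot_zeta24 : IsPrimitiveRoot zeta24 24 := by
  simpa [zeta24] using Complex.isPrimitiveRoot_exp 24 (by norm_num)

lemma norm_zeta24 : ‖zeta24‖ = 1 := isPrimitiveRoot_zeta24.norm'_eq_one (by norm_num)

lemma zeta24_zpow_eq_one_iff {n : ℤ} : zeta24 ^ n = 1 ↔ (24 : ℤ) ∣ n := by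
  simpa using isPrimitiveRoot_zeta24.zpow_eq_one_iff_dvd n

lemma zeta24_pow_twelve : zeta24 ^ 12 = -1 := by
  rw [zeta24, ← Complex.exp_nat_mul, ← Complex.exp_pi_mul_I]
  congr 1
  push_cast
  ring

lemma eta_add_one (z : ℂ) : η (z + 1) = zeta24 * η z := by
  have h24 : Function.Periodic.qParam 24 (z + 1) = zeta24 * Function.Periodic.qParam 24 z := by
    simp only [Function.Periodic.qParam, zeta24, ← Complex.exp_add]
    congr 1
    push_cast
    ring
  have h1 : Function.Periodic.qParam 1 (z + 1) = Function.Periodic.qParam 1 z := by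
    rw [Function.Periodic.qParam, Function.Periodic.qParam,
      ← Complex.exp_periodic (2 * π * I * z / (1 : ℝ))]
    congr 1
    push_cast
    ring
  simp only [ModularForm.eta, eta_q, h24, h1, mul_assoc]

lemma eta_add_int (z : ℂ) (n : ℤ) : η (z + n) = zeta24 ^ n * η z := by
  induction n using Int.induction_on with
  | zero => simp
  | succ n ih =>
    push_cast at ih ⊢
    rw [← add_assoc, eta_add_one, ih, zpow_add_one₀ zeta24_ne_zero]
    ring
  | pred n ih =>
    have h := eta_add_one (z + ((-n - 1 : ℤ) : ℂ))
    rw [show z + ((-n - 1 : ℤ) : ℂ) + 1 = z + ((-n : ℤ) : ℂ) by push_cast; ring, ih] at h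
    rw [zpow_sub_one₀ zeta24_ne_zero]
    field_simp [zeta24_ne_zero]
    linear_combination -h

/-- The principal square root is multiplicative as long as the arguments do not add up to more
than `π`. -/
lemma sqrt_mul_of_im_nonneg {x y : ℂ} (hx : 0 < x.im) (hy : 0 ≤ y.im) (hy0 : y ≠ 0)
    (hxy : 0 ≤ (x * y).im) : sqrt (x * y) = sqrt x * sqrt y := by
  have hx0 : x ≠ 0 := by rintro rfl; simp at hx
  have hax : 0 < x.arg := lt_of_le_of_ne (arg_nonneg_iff.2 hx.le)
    (fun h => hx.ne' (arg_eq_zero_iff.1 h.symm).2)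
  have hax' : x.arg < π := arg_lt_pi_iff.2 (Or.inr hx.ne')
  have hay : 0 ≤ y.arg := arg_nonneg_iff.2 hy
  have hay' : y.arg ≤ π := arg_le_pi y
  have hsum : x.arg + y.arg ≤ π := by
    by_contra! hlt
    have him : (x * y).im = ‖x‖ * ‖y‖ * Real.sin (x.arg + y.arg) := by
      rw [Real.sin_add, mul_im]
      conv_lhs => rw [← norm_mul_cos_arg x, ← norm_mul_cos_arg y, ← norm_mul_sin_arg x,
        ← norm_mul_sin_arg y]
      ring
    have hsin : Real.sin (x.arg + y.arg) < 0 := by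
      have := Real.sin_pos_of_pos_of_lt_pi (x := x.arg + y.arg - π) (by linarith) (by linarith)
      rw [Real.sin_sub_pi] at this
      linarith
    have : 0 < ‖x‖ * ‖y‖ := mul_pos (norm_pos_iff.2 hx0) (norm_pos_iff.2 hy0)
    nlinarith
  rw [sqrt_eq_exp hx0, sqrt_eq_exp hy0, sqrt_eq_exp (mul_ne_zero hx0 hy0),
    log_mul hx0 hy0 ⟨by linarith, hsum⟩, ← Complex.exp_add]
  congr 1
  ring

lemma sqrt_sq_eq_self (z : ℂ) : sqrt z ^ 2 = z := by
  rcases eq_or_ne z 0 with rfl | hz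
  · simp [sqrt]
  · rw [sqrt_eq_exp hz, ← Complex.exp_nat_mul]
    push_cast
    rw [mul_div_cancel₀ _ two_ne_zero, exp_log hz]

lemma sqrt_ne_zero' {z : ℂ} (hz : z ≠ 0) : sqrt z ≠ 0 := by
  rw [sqrt_eq_exp hz]; exact exp_ne_zero _

lemma im_div_add_one_pos {z : ℂ} (hz : 0 < z.im) : 0 < (z / (z + 1)).im := by
  have h1 : z + 1 ≠ 0 := fun h => by
    have := congrArg Complex.im h
    simp at this; linarith
  have : z / (z + 1) = 1 - (z + 1)⁻¹ := by field_simp; ring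
  rw [this]
  have h2 : 0 < normSq (z + 1) := normSq_pos.2 h1
  simp only [sub_im, one_im, inv_im, add_im, add_zero]
  rw [neg_div, zero_sub, neg_neg]
  positivity

/-- The transformation of `η` under the lower triangular generator `z ↦ z / (z + 1)`. -/
lemma eta_div_add_one {z : ℂ} (hz : 0 < z.im) :
    η (z / (z + 1)) = zeta24⁻¹ * sqrt (z + 1) * η z := by
  have hz0 : z ≠ 0 := by rintro rfl; simp at hz
  have hu : 0 < (z + 1).im := by simpa using hz
  have hu0 : z + 1 ≠ 0 := fun h => by rw [h] at hu; simp at hu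
  set v := z / (z + 1) with hv
  have hvim : 0 < v.im := im_div_add_one_pos hz
  have hv0 : v ≠ 0 := div_ne_zero hz0 hu0
  have hI : sqrt I ≠ 0 := sqrt_ne_zero' I_ne_zero
  have e1 : η (-1 / v) = (sqrt I)⁻¹ * (sqrt v * η v) := by
    simpa using eta_comp_eq_csqrt_I_inv hvim
  have e2 : η (-1 / z) = (sqrt I)⁻¹ * (sqrt z * η z) := by
    simpa using eta_comp_eq_csqrt_I_inv hz
  have e3 : -1 / z = -1 / v + 1 := by rw [hv]; field_simp; ring
  have e4 : sqrt z = sqrt (z + 1) * sqrt v := by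
    have : z = (z + 1) * v := by rw [hv]; field_simp
    conv_lhs => rw [this]
    exact sqrt_mul_of_im_nonneg hu hvim.le hv0 (by rw [← this]; exact hz.le)
  rw [e3, eta_add_one, e1, e4] at e2
  have hsv : sqrt v ≠ 0 := sqrt_ne_zero' hv0
  field_simp [zeta24_ne_zero] at e2 ⊢
  linear_combination e2

/-- The Möbius transformation with matrix `!![a, b; c, d]` acts on `η` with the multiplier
`zeta24 ^ n`, where the automorphy factor is the principal square root of `c z + d`. -/
def HasEtaMultiplier (a b c d n : ℤ) : Prop :=
  ∀ z : ℂ, 0 < z.im → η ((a * z + b) / (c * z + d)) = zeta24 ^ n * sqrt (c * z + d) * η z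

lemma hasEtaMultiplier_translation (b : ℤ) : HasEtaMultiplier 1 b 0 1 b := fun z _ => by
  simp [eta_add_int, sqrt]

lemma HasEtaMultiplier.add_right {a b c d n : ℤ} (h : HasEtaMultiplier a b c d n) :
    HasEtaMultiplier a (a + b) c (c + d) (n + 1) := fun z hz => by
  have := h (z + 1) (by simpa using hz)
  rw [eta_add_one] at this
  rw [zpow_add_one₀ zeta24_ne_zero]
  push_cast
  rw [show (a : ℂ) * z + (a + b) = a * (z + 1) + b by ring,
    show (c : ℂ) * z + (c + d) = c * (z + 1) + d by ring, this]
  ring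

lemma HasEtaMultiplier.add_left {a b c d n : ℤ} (h : HasEtaMultiplier a b c d n)
    (hc : 0 ≤ c) (hd : 0 < d) : HasEtaMultiplier (a + b) b (c + d) d (n - 1) := fun z hz => by
  have hu : 0 < (z + 1).im := by simpa using hz
  have hu0 : z + 1 ≠ 0 := fun h => by rw [h] at hu; simp at hu
  have hv := im_div_add_one_pos hz
  have hc' : (0 : ℝ) ≤ c := by exact_mod_cast hc
  have hd' : (0 : ℝ) < d := by exact_mod_cast hd
  set w : ℂ := c * (z / (z + 1)) + d with hw
  have hwim : 0 ≤ w.im := by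
    have : w.im = c * (z / (z + 1)).im := by rw [hw]; simp
    rw [this]; positivity
  have e1 : ((c + d : ℤ) : ℂ) * z + d = (z + 1) * w := by
    rw [hw]; push_cast; field_simp; ring
  have him : 0 < (((c + d : ℤ) : ℂ) * z + d).im := by
    have : (((c + d : ℤ) : ℂ) * z + d).im = (c + d) * z.im := by
      push_cast; simp
    rw [this]; positivity
  have hw0 : w ≠ 0 := fun h0 => by rw [e1, h0] at him; simp at him
  have := h _ hv
  rw [eta_div_add_one hz] at this
  have e2 : (((a + b : ℤ) : ℂ) * z + b) / (((c + d : ℤ) : ℂ) * z + d)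
      = (a * (z / (z + 1)) + b) / w := by
    rw [e1]
    field_simp
    push_cast
    ring
  rw [e2, this, e1, sqrt_mul_of_im_nonneg hu hwim hw0 (by rw [← e1]; exact him.le),
    zpow_sub_one₀ zeta24_ne_zero]
  ring

end

/-! ### The eta multiplier and the Jacobi symbol -/

noncomputable section

open ModularForm Complex
open scoped Real NumberTheorySymbols

lemma zmod_eight_natCast_odd {n : ℕ} (h : Odd n) : (4 * n : ZMod 8) = 4 := by
  have : ((4 * n : ℕ) : ZMod 8) = ((4 : ℕ) : ZMod 8) := by
    rw [ZMod.natCast_eq_natCast_iff, Nat.ModEq]; obtain ⟨m, rfl⟩ := h; omega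
  exact_mod_cast this

lemma zmod_eight_natCast_even {n : ℕ} (h : Even n) : (4 * n : ZMod 8) = 0 := by
  have : ((4 * n : ℕ) : ZMod 8) = ((0 : ℕ) : ZMod 8) := by
    rw [ZMod.natCast_eq_natCast_iff, Nat.ModEq]; obtain ⟨m, rfl⟩ := h; omega
  exact_mod_cast this

lemma zmod_eight_two_mul_eq_two {n : ℕ} : (2 * n : ZMod 8) = 2 ↔ n % 4 = 1 := by
  have : ((2 * n : ℕ) : ZMod 8) = ((2 : ℕ) : ZMod 8) ↔ n % 4 = 1 := by
    rw [ZMod.natCast_eq_natCast_iff, Nat.ModEq]; omega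
  exact_mod_cast this

lemma zmod_eight_two_mul_eq_four {n : ℕ} : (2 * n : ZMod 8) = 4 ↔ n % 4 = 2 := by
  have : ((2 * n : ℕ) : ZMod 8) = ((4 : ℕ) : ZMod 8) ↔ n % 4 = 2 := by
    rw [ZMod.natCast_eq_natCast_iff, Nat.ModEq]; omega
  exact_mod_cast this

lemma zmod_eight_two_mul_eq_six {n : ℕ} : (2 * n : ZMod 8) = 6 ↔ n % 4 = 3 := by
  have : ((2 * n : ℕ) : ZMod 8) = ((6 : ℕ) : ZMod 8) ↔ n % 4 = 3 := by
    rw [ZMod.natCast_eq_natCast_iff, Nat.ModEq]; omega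
  exact_mod_cast this

/-- Jacobi symbols with even numerator are not periodic in the denominator under adding the
numerator itself; reciprocity gives the correction in terms of residues modulo `4`. -/
lemma jacobiSym_even_add {c d : ℕ} (hc : Even c) (hd : Odd d) :
    J(c | c + d) = if d % 4 = 1 ∧ c % 4 = 2 then -J(c | d) else J(c | d) := by
  have hD : Odd (c + d) := hc.add_odd hd
  have e1 : J(c | c + d) = J(-d | c + d) := by
    apply jacobiSym.mod_left'
    exact (Int.modEq_iff_dvd.2 ⟨1, by push_cast; ring⟩ : (-d : ℤ) ≡ c [ZMOD (c + d : ℕ)]).symm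
  have e2 : J(c | d) = J((c + d : ℕ) | d) := by
    apply jacobiSym.mod_left'
    push_cast
    simp
  rw [e1, jacobiSym.neg _ hD, e2]
  have hd2 := Nat.odd_iff.1 hd
  have hD2 := Nat.odd_iff.1 hD
  have hc2 := Nat.even_iff.1 hc
  rw [← jacobiSym.quadratic_reciprocity_if hd2 hD2]
  rcases Nat.odd_mod_four_iff.1 hd2 with h1 | h3
  · rcases Nat.odd_mod_four_iff.1 hD2 with h1' | h3'
    · rw [ZMod.χ₄_nat_one_mod_four h1', if_neg (by omega), if_neg (by omega), one_mul]
    · rw [ZMod.χ₄_nat_three_mod_four h3', if_neg (by omega), if_pos (by omega), neg_one_mul]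
  · rcases Nat.odd_mod_four_iff.1 hD2 with h1' | h3'
    · rw [ZMod.χ₄_nat_one_mod_four h1', if_neg (by omega), if_neg (by omega), one_mul]
    · rw [ZMod.χ₄_nat_three_mod_four h3', if_pos (by omega), if_neg (by omega), neg_one_mul,
        neg_neg]

/-- The class modulo `8` of the exponent of the `η`-multiplier, in terms of a lower row with odd
right entry `d`; the variable `j` stands for the Jacobi symbol `(c / d)`, and `2 - 2 * j` is `0` or
`4` according to its sign. -/
def etaExpOddRight (a b c d j : ZMod 8) : ZMod 8 :=
  (a + d) * c - b * d * (c ^ 2 - 1) + 3 * d - 3 - 3 * c * d + 2 - 2 * j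

/-- The class modulo `8` of the exponent of the `η`-multiplier, in terms of a lower row with odd
left entry `c`; the variable `j` stands for the Jacobi symbol `(d / c)`. -/
def etaExpOddLeft (a b c d j : ZMod 8) : ZMod 8 :=
  (a + d) * c - b * d * (c ^ 2 - 1) - 3 * c + 2 - 2 * j

set_option synthInstance.maxSize 1000 in
set_option synthInstance.maxHeartbeats 200000 in
/-- The sign condition is the one of quadratic reciprocity: modulo `8`, the equation `4 * x = 4`
says that `x` is odd and `2 * x = 6` that it is `3` modulo `4`. -/
lemma etaExpOddRight_eq_etaExpOddLeft : ∀ a b c d : ZMod 8, a * d - b * c = 1 →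
    4 * c = 4 → 4 * d = 4 → ∀ j : ZMod 8, 2 * j = 2 ∨ 2 * j = -2 →
    etaExpOddRight a b c d (if 2 * c = 6 ∧ 2 * d = 6 then -j else j) =
      etaExpOddLeft a b c d j := by
  unfold etaExpOddRight etaExpOddLeft
  decide +kernel

lemma etaExpOddLeft_add_right : ∀ a b c d j : ZMod 8, 4 * c = 4 →
    etaExpOddLeft a (a + b) c (c + d) j = etaExpOddLeft a b c d j + 1 := by
  unfold etaExpOddLeft
  decide +kernel

/-- The sign condition is the one of `jacobiSym_even_add`. -/
lemma etaExpOddRight_add_right : ∀ a b c d : ZMod 8, a * d - b * c = 1 →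
    4 * c = 0 → 4 * d = 4 → ∀ j : ZMod 8, 2 * j = 2 ∨ 2 * j = -2 →
    etaExpOddRight a (a + b) c (c + d) (if 2 * d = 2 ∧ 2 * c = 4 then -j else j) =
      etaExpOddRight a b c d j + 1 := by
  unfold etaExpOddRight
  decide +kernel

lemma etaExpOddRight_add_left : ∀ a b c d : ZMod 8, a * d - b * c = 1 → 4 * d = 4 →
    ∀ j : ZMod 8, etaExpOddRight (a + b) b (c + d) d j = etaExpOddRight a b c d j - 1 := by
  unfold etaExpOddRight
  decide +kernel

/-- The sign condition is the one of `jacobiSym_even_add`. -/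
lemma etaExpOddLeft_add_left : ∀ a b c d : ZMod 8, a * d - b * c = 1 →
    4 * c = 4 → 4 * d = 0 → ∀ j : ZMod 8, 2 * j = 2 ∨ 2 * j = -2 →
    etaExpOddLeft (a + b) b (c + d) d (if 2 * c = 2 ∧ 2 * d = 4 then -j else j) =
      etaExpOddLeft a b c d j - 1 := by
  unfold etaExpOddLeft
  decide +kernel

lemma jacobiSym_cast_eq_one_or {c d : ℕ} (h : c.Coprime d) :
    2 * (J(c | d) : ZMod 8) = 2 ∨ 2 * (J(c | d) : ZMod 8) = -2 := by
  rcases jacobiSym.eq_one_or_neg_one (a := c) (b := d) (by simpa using h) with h | h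
  · left; rw [h]; decide
  · right; rw [h]; decide

/-- The integer `n` is an exponent of the `η`-multiplier of the matrix `!![a, b; c, d]`, and its
class modulo `24` is the one predicted by the classical formula, which involves the Jacobi symbol
`(c / d)` or `(d / c)` according to which entry of the lower row is odd. -/
structure IsEtaExponent (a b : ℤ) (c d : ℕ) (n : ℤ) : Prop where
  hasEtaMultiplier : HasEtaMultiplier a b c d n
  mod_three : (n : ZMod 3) = (a + d) * c - b * d * (c ^ 2 - 1)
  mod_eight_of_odd_right : Odd d → (n : ZMod 8) = etaExpOddRight a b c d J(c | d)
  mod_eight_of_odd_left : Odd c → (n : ZMod 8) = etaExpOddLeft a b c d J(d | c)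

lemma mod_three_add_right : ∀ a b c d : ZMod 3, a * d - b * c = 1 →
    (a + (c + d)) * c - (a + b) * (c + d) * (c ^ 2 - 1) =
      (a + d) * c - b * d * (c ^ 2 - 1) + 1 := by
  decide +kernel

lemma mod_three_add_left : ∀ a b c d : ZMod 3, a * d - b * c = 1 →
    (a + b + d) * (c + d) - b * d * ((c + d) ^ 2 - 1) =
      (a + d) * c - b * d * (c ^ 2 - 1) - 1 := by
  decide +kernel

lemma coprime_of_det {a b : ℤ} {c d : ℕ} (h : a * d - b * c = 1) : c.Coprime d := by
  rw [← Nat.isCoprime_iff_coprime]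
  exact ⟨-b, a, by linear_combination h⟩

/-- Quadratic reciprocity matches the two formulas for the exponent when both entries of the
lower row are odd. -/
lemma etaExp_reciprocity {a b : ℤ} {c d : ℕ} (h : a * d - b * c = 1) (hc : Odd c) (hd : Odd d) :
    etaExpOddRight a b c d J(c | d) = etaExpOddLeft a b c d J(d | c) := by
  have hdet : (a : ZMod 8) * d - b * c = 1 := by exact_mod_cast congrArg (Int.cast (R := ZMod 8)) h
  rw [← etaExpOddRight_eq_etaExpOddLeft a b c d hdet (zmod_eight_natCast_odd hc)
    (zmod_eight_natCast_odd hd) _ (jacobiSym_cast_eq_one_or (coprime_of_det h).symm)]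
  simp only [zmod_eight_two_mul_eq_six]
  rw [← jacobiSym.quadratic_reciprocity_if (Nat.odd_iff.1 hc) (Nat.odd_iff.1 hd)]
  split_ifs <;> simp

lemma IsEtaExponent.add_right {a b : ℤ} {c d : ℕ} {n : ℤ} (h : a * d - b * c = 1)
    (H : IsEtaExponent a b c d n) : IsEtaExponent a (a + b) c (c + d) (n + 1) := by
  have hdet (m : ℕ) : (a : ZMod m) * d - b * c = 1 := by
    exact_mod_cast congrArg (Int.cast (R := ZMod m)) h
  have h' : a * (c + d : ℕ) - (a + b) * c = 1 := by push_cast; linear_combination h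
  have hleft (hc : Odd c) : ((n + 1 : ℤ) : ZMod 8) =
      etaExpOddLeft a (a + b : ℤ) c (c + d : ℕ) J((c + d : ℕ) | c) := by
    push_cast
    rw [etaExpOddLeft_add_right _ _ _ _ _ (zmod_eight_natCast_odd hc),
      H.mod_eight_of_odd_left hc]
    congr 3
    exact jacobiSym.mod_left' (by simp)
  refine ⟨by simpa using H.hasEtaMultiplier.add_right, ?_, fun hD => ?_, hleft⟩
  · push_cast
    rw [mod_three_add_right _ _ _ _ (hdet 3), H.mod_three]
  · rcases Nat.even_or_odd c with hc | hc
    · have hd : Odd d := by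
        rcases Nat.even_or_odd d with hd | hd
        · exact absurd hD (by simpa using hc.add hd)
        · exact hd
      rw [jacobiSym_even_add hc hd]
      push_cast
      rw [H.mod_eight_of_odd_right hd, ← etaExpOddRight_add_right _ _ _ _ (hdet 8)
        (zmod_eight_natCast_even hc) (zmod_eight_natCast_odd hd) _
        (jacobiSym_cast_eq_one_or (coprime_of_det h))]
      simp only [zmod_eight_two_mul_eq_two, zmod_eight_two_mul_eq_four]
    · rw [hleft hc, etaExp_reciprocity h' hc hD]

lemma IsEtaExponent.add_left {a b : ℤ} {c d : ℕ} {n : ℤ} (h : a * d - b * c = 1) (hd0 : 0 < d)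
    (H : IsEtaExponent a b c d n) : IsEtaExponent (a + b) b (c + d) d (n - 1) := by
  have hdet (m : ℕ) : (a : ZMod m) * d - b * c = 1 := by
    exact_mod_cast congrArg (Int.cast (R := ZMod m)) h
  have h' : (a + b) * d - b * (c + d : ℕ) = 1 := by push_cast; linear_combination h
  have hright (hd : Odd d) : ((n - 1 : ℤ) : ZMod 8) =
      etaExpOddRight (a + b : ℤ) b (c + d : ℕ) d J((c + d : ℕ) | d) := by
    push_cast
    rw [etaExpOddRight_add_left _ _ _ _ (hdet 8) (zmod_eight_natCast_odd hd),
      H.mod_eight_of_odd_right hd]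
    congr 3
    exact jacobiSym.mod_left' (by simp)
  refine ⟨?_, ?_, hright, fun hC => ?_⟩
  · simpa using H.hasEtaMultiplier.add_left (by positivity) (by exact_mod_cast hd0)
  · push_cast
    rw [mod_three_add_left _ _ _ _ (hdet 3), H.mod_three]
  · rcases Nat.even_or_odd d with hd | hd
    · have hc : Odd c := by
        rcases Nat.even_or_odd c with hc | hc
        · exact absurd hC (by simpa using hc.add hd)
        · exact hc
      rw [add_comm c d, jacobiSym_even_add hd hc, add_comm d c]
      push_cast
      rw [H.mod_eight_of_odd_left hc, ← etaExpOddLeft_add_left _ _ _ _ (hdet 8)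
        (zmod_eight_natCast_odd hc) (zmod_eight_natCast_even hd) _
        (jacobiSym_cast_eq_one_or (coprime_of_det h).symm)]
      simp only [zmod_eight_two_mul_eq_two, zmod_eight_two_mul_eq_four]
    · rw [hright hd, etaExp_reciprocity h' hC hd]

/-- Every integral matrix of determinant one whose lower row is non-negative with positive right
entry has an `η`-multiplier as in the classical formula. The proof is the Euclidean algorithm on
the lower row. -/
theorem exists_isEtaExponent (a b : ℤ) (c d : ℕ) (hd : 0 < d) (h : a * d - b * c = 1) :
    ∃ n, IsEtaExponent a b c d n := by
  induction hs : c + d using Nat.strong_induction_on generalizing a b c d with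
  | _ s ih =>
    rcases Nat.eq_zero_or_pos c with rfl | hc
    · have had : a * d = 1 := by simpa using h
      have hd1 : (d : ℤ) = 1 :=
        Int.eq_one_of_dvd_one (by positivity) ⟨a, by linear_combination -had⟩
      obtain rfl : d = 1 := by exact_mod_cast hd1
      obtain rfl : a = 1 := by simpa using had
      refine ⟨b, by simpa using hasEtaMultiplier_translation b, by simp, fun _ => ?_, by simp⟩
      simp [etaExpOddRight]
    · rcases le_or_gt d c with hle | hlt
      · obtain ⟨c', rfl⟩ := Nat.exists_eq_add_of_le' hle
        have h' : (a - b) * d - b * c' = 1 := by push_cast at h; linear_combination h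
        obtain ⟨n, hn⟩ := ih (c' + d) (by omega) (a - b) b c' d hd h' rfl
        exact ⟨n - 1, by simpa using hn.add_left h' hd⟩
      · obtain ⟨d', rfl⟩ := Nat.exists_eq_add_of_le hlt.le
        have h' : a * d' - (b - a) * c = 1 := by push_cast at h; linear_combination h
        obtain ⟨n, hn⟩ := ih (c + d') (by omega) a (b - a) c d' (by omega) h' rfl
        exact ⟨n + 1, by simpa using hn.add_right h'⟩

/-- On the principal congruence subgroup of level `24`, the `η`-multiplier is the Jacobi symbol
`(c / d)`. -/
theorem eta_smul_of_modEq_one {a b : ℤ} {c d : ℕ} (hd : 0 < d) (h : a * d - b * c = 1)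
    (ha1 : (a : ZMod 24) = 1) (hb1 : (b : ZMod 24) = 0) (hc1 : (c : ZMod 24) = 0)
    (hd1 : (d : ZMod 24) = 1) {z : ℂ} (hz : 0 < z.im) :
    η ((a * z + b) / (c * z + d)) = J(c | d) * sqrt (c * z + d) * η z := by
  obtain ⟨n, hn⟩ := exists_isEtaExponent a b c d hd h
  have red (m : ℕ) (hm : m ∣ 24) : (a : ZMod m) = 1 ∧ (b : ZMod m) = 0 ∧ (c : ZMod m) = 0 ∧
      (d : ZMod m) = 1 := by
    refine ⟨?_, ?_, ?_, ?_⟩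
    · simpa only [map_intCast, map_natCast, map_one] using congrArg (ZMod.castHom hm (ZMod m)) ha1
    · simpa using congrArg (ZMod.castHom hm (ZMod m)) hb1
    · simpa using congrArg (ZMod.castHom hm (ZMod m)) hc1
    · simpa only [map_intCast, map_natCast, map_one] using congrArg (ZMod.castHom hm (ZMod m)) hd1
  have h3 : (3 : ℤ) ∣ n := by
    obtain ⟨ha, hb, hc, hd⟩ := red 3 (by norm_num)
    have := hn.mod_three
    rw [ha, hb, hc, hd] at this
    exact (ZMod.intCast_zmod_eq_zero_iff_dvd n 3).1 (by simpa using this)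
  have hodd : Odd d := by
    have := (red 2 (by norm_num)).2.2.2
    rwa [ZMod.natCast_eq_one_iff_odd] at this
  have h8 : ((n + 2 * J(c | d) - 2 : ℤ) : ZMod 8) = 0 := by
    obtain ⟨ha, hb, hc, hd⟩ := red 8 (by norm_num)
    have := hn.mod_eight_of_odd_right hodd
    rw [ha, hb, hc, hd, etaExpOddRight] at this
    push_cast
    rw [this]
    ring
  have h8' : (8 : ℤ) ∣ n + 2 * J(c | d) - 2 :=
    (ZMod.intCast_zmod_eq_zero_iff_dvd _ 8).1 h8
  -- The formula gives `n ≡ 2 - 2 J` modulo `8`, that is `n ≡ 0` or `n ≡ 12` modulo `24`.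
  have key : zeta24 ^ n = J(c | d) := by
    rcases jacobiSym.eq_one_or_neg_one (a := c) (b := d)
      (by simpa using coprime_of_det h) with hj | hj
    · rw [hj] at h8' ⊢
      simpa using zeta24_zpow_eq_one_iff.2 (by omega : (24 : ℤ) ∣ n)
    · rw [hj] at h8' ⊢
      have : zeta24 ^ (n - 12 + (12 : ℕ)) = -1 := by
        rw [zpow_add₀ zeta24_ne_zero, zpow_natCast, zeta24_pow_twelve,
          zeta24_zpow_eq_one_iff.2 (by omega), one_mul]
      simpa using this
  have := hn.hasEtaMultiplier z hz
  rw [key] at this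
  exact_mod_cast this

end

/-! ### Invariance of eta-quotients of prime level -/

noncomputable section

open ModularForm Complex
open scoped Real NumberTheorySymbols MatrixGroups
open UpperHalfPlane hiding I
open Matrix.SpecialLinearGroup (mapGL)

/-- The function `η(z) ^ r * η(p z) ^ s`. -/
def etaPair (p : ℕ) (r s : ℤ) (z : ℍ) : ℂ := η z ^ r * η (p * z) ^ s

lemma etaQuotient_prime {p : ℕ} (hp : p.Prime) (r : ℕ → ℤ) :
    etaQuotient p r = etaPair p (r 1) (r p) := by
  ext z
  rw [etaQuotient, hp.divisors, Finset.prod_pair hp.one_lt.ne, etaPair]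
  simp

lemma natCast_mul_im_pos {p : ℕ} (hp : 0 < p) (z : ℍ) : 0 < ((p : ℂ) * z).im := by
  have : ((p : ℂ) * z).im = p * z.im := by simp
  rw [this]
  have := z.im_pos
  positivity

lemma etaPair_ne_zero {p : ℕ} (hp : 0 < p) (r s : ℤ) (z : ℍ) : etaPair p r s z ≠ 0 :=
  mul_ne_zero (zpow_ne_zero _ (eta_ne_zero z.im_pos))
    (zpow_ne_zero _ (eta_ne_zero (natCast_mul_im_pos hp z)))

lemma coe_SL_smul (γ : SL(2, ℤ)) (z : ℍ) :
    ((γ • z : ℍ) : ℂ) = (γ 0 0 * z + γ 0 1) / (γ 1 0 * z + γ 1 1) := by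
  simpa using coe_specialLinearGroup_apply γ z

lemma etaPair_T_smul (p : ℕ) (r s : ℤ) (z : ℍ) :
    etaPair p r s (ModularGroup.T • z) = zeta24 ^ (r + p * s) * etaPair p r s z := by
  have h : ((ModularGroup.T • z : ℍ) : ℂ) = z + 1 := by
    rw [coe_SL_smul]; simp [ModularGroup.T]
  have h2 : (p : ℂ) * (z + 1) = p * z + (p : ℤ) := by push_cast; ring
  rw [etaPair, h, h2, eta_add_one, eta_add_int, etaPair, mul_zpow, mul_zpow, ← zpow_mul,
    zpow_add₀ zeta24_ne_zero]
  ring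

/-- The lower unitriangular matrix `!![1, 0; x, 1]`. -/
def lowerUnipotent (x : ℤ) : SL(2, ℤ) := ⟨!![1, 0; x, 1], by simp⟩

lemma coe_lowerUnipotent (x : ℤ) :
    (lowerUnipotent x : Matrix (Fin 2) (Fin 2) ℤ) = !![1, 0; x, 1] := rfl

lemma lowerUnipotent_zpow (x n : ℤ) : lowerUnipotent x ^ n = lowerUnipotent (n * x) := by
  have hmul (x y : ℤ) : lowerUnipotent x * lowerUnipotent y = lowerUnipotent (x + y) := by
    ext i j
    fin_cases i <;> fin_cases j <;> simp [coe_lowerUnipotent]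
  have h0 : lowerUnipotent 0 = 1 := by
    ext i j
    fin_cases i <;> fin_cases j <;> simp [coe_lowerUnipotent]
  induction n using Int.induction_on with
  | zero => simp [h0]
  | succ n ih => rw [zpow_add_one, ih, hmul]; congr 1; ring
  | pred n ih =>
    rw [zpow_sub_one, ih, mul_inv_eq_iff_eq_mul, hmul]; congr 1; ring

lemma hasEtaMultiplier_lower (m : ℕ) : HasEtaMultiplier 1 0 m 1 (-m) := by
  induction m with
  | zero => simpa using hasEtaMultiplier_translation 0
  | succ m ih =>
    have := ih.add_left (by positivity) one_pos
    push_cast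
    rwa [show (-(m + 1) : ℤ) = -m - 1 by ring]

/-- The Möbius map `z ↦ z / (p z + 1)` acts on `p z` as `w ↦ w / (w + 1)`. -/
lemma etaPair_lowerUnipotent_smul (p : ℕ) (hp : 0 < p) (r s : ℤ) (z : ℍ) :
    etaPair p r s (lowerUnipotent p • z) =
      zeta24 ^ (-(p * r + s)) * sqrt (p * z + 1) ^ (r + s) * etaPair p r s z := by
  have h : ((lowerUnipotent p • z : ℍ) : ℂ) = z / (p * z + 1) := by
    rw [coe_SL_smul]; simp [coe_lowerUnipotent]
  have e1 : η (z / (p * z + 1)) = zeta24 ^ (-p : ℤ) * sqrt (p * z + 1) * η z := by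
    simpa using hasEtaMultiplier_lower p z z.im_pos
  have e2 := eta_div_add_one (natCast_mul_im_pos hp z)
  have hs : sqrt (p * z + 1) ≠ 0 := by
    refine sqrt_ne_zero' fun h => ?_
    have h1 : ((p : ℂ) * z + 1).im = p * z.im := by simp
    rw [h] at h1
    have := mul_pos (Nat.cast_pos (α := ℝ).2 hp) z.im_pos
    simp at h1
    rcases h1 with h1 | h1
    · omega
    · exact z.im_pos.ne' h1
  rw [etaPair, h, e1, mul_div_assoc', e2, etaPair]
  simp only [mul_zpow]
  rw [← zpow_mul, ← zpow_neg_one, ← zpow_mul, zpow_add₀ hs,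
    show (-(p * r + s) : ℤ) = -p * r + -1 * s by ring, zpow_add₀ zeta24_ne_zero]
  ring

/-- The subgroup of the modular group fixing a function under the weight `k` slash action. -/
def slashStabilizer (f : ℍ → ℂ) (k : ℤ) : Subgroup SL(2, ℤ) where
  carrier := {γ | f ∣[k] γ = f}
  mul_mem' {x y} hx hy := by
    simp only [Set.mem_ofPred_eq] at *
    rw [SlashAction.slash_mul, hx, hy]
  one_mem' := SlashAction.slash_one k f
  inv_mem' {x} hx := by
    simp only [Set.mem_ofPred_eq] at *
    conv_lhs => rw [← hx]
    rw [← SlashAction.slash_mul, mul_inv_cancel, SlashAction.slash_one]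

lemma mem_slashStabilizer_iff {f : ℍ → ℂ} {k : ℤ} {γ : SL(2, ℤ)} :
    γ ∈ slashStabilizer f k ↔ ∀ z : ℍ, f (γ • z) = ((γ 1 0 : ℂ) * z + γ 1 1) ^ k * f z := by
  simp only [← slash_action_eq'_iff, ← funext_iff]
  rfl

lemma T_mem_slashStabilizer_iff {p : ℕ} (hp : 0 < p) {r s k : ℤ} :
    ModularGroup.T ∈ slashStabilizer (etaPair p r s) k ↔ (24 : ℤ) ∣ r + p * s := by
  rw [mem_slashStabilizer_iff, ← zeta24_zpow_eq_one_iff]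
  simp only [etaPair_T_smul]
  constructor
  · intro h
    have := h UpperHalfPlane.I
    rw [mul_left_inj' (etaPair_ne_zero hp _ _ _)] at this
    simpa [ModularGroup.T] using this
  · intro h z
    rw [h]
    simp [ModularGroup.T]

lemma lowerUnipotent_mem_slashStabilizer_iff {p : ℕ} (hp : 0 < p) {r s k : ℤ} :
    lowerUnipotent p ∈ slashStabilizer (etaPair p r s) k ↔
      r + s = 2 * k ∧ (24 : ℤ) ∣ p * r + s := by
  rw [mem_slashStabilizer_iff, ← dvd_neg, ← zeta24_zpow_eq_one_iff]
  simp only [etaPair_lowerUnipotent_smul p hp]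
  have hpos (w : ℂ) (k : ℤ) : w ^ k = sqrt w ^ (2 * k) := by
    rw [zpow_mul, zpow_ofNat, sqrt_sq_eq_self]
  constructor
  · intro h
    have h1 := h UpperHalfPlane.I
    rw [mul_left_inj' (etaPair_ne_zero hp _ _ _)] at h1
    simp only [coe_lowerUnipotent, Matrix.of_apply, Matrix.cons_val', Matrix.cons_val_zero,
      Matrix.cons_val_one, Matrix.cons_val_fin_one, Int.cast_natCast, Int.cast_one] at h1
    -- Comparing absolute values at `i` of the two automorphy factors determines the weight.
    set w : ℂ := p * (UpperHalfPlane.I : ℍ) + 1 with hw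
    have hnorm : 1 < ‖w‖ := by
      have : (1 : ℝ) < normSq w := by
        rw [hw, normSq_apply]
        have : (0 : ℝ) < p := by exact_mod_cast hp
        simp
        positivity
      rw [normSq_eq_norm_sq] at this
      nlinarith [norm_nonneg w]
    have hw0 : w ≠ 0 := fun h => by simp [h] at hnorm; linarith
    have hs1 : 1 < ‖sqrt w‖ := by
      rw [← sqrt_sq_eq_self w, norm_pow] at hnorm
      nlinarith [norm_nonneg (sqrt w)]
    have hs0 : sqrt w ≠ 0 := sqrt_ne_zero' hw0
    rw [hpos w] at h1
    have h2 := congrArg norm h1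
    rw [norm_mul, norm_zpow, norm_zeta24, one_zpow, one_mul, norm_zpow, norm_zpow,
      zpow_right_inj₀ (by linarith) hs1.ne'] at h2
    refine ⟨h2, ?_⟩
    rw [h2] at h1
    exact mul_right_cancel₀ (zpow_ne_zero _ hs0) (by rw [h1, one_mul])
  · rintro ⟨h1, h2⟩ z
    rw [h1, h2, one_mul, ← hpos]
    simp [coe_lowerUnipotent]

lemma sq_zmod_twentyfour_eq_one {p : ℕ} (hp : p.Prime) (hp3 : 3 < p) : (p : ZMod 24) ^ 2 = 1 := by
  have h2 : ¬ 2 ∣ p := fun h => by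
    have := (Nat.prime_dvd_prime_iff_eq Nat.prime_two hp).1 h; omega
  have h3 : ¬ 3 ∣ p := fun h => by
    have := (Nat.prime_dvd_prime_iff_eq Nat.prime_three hp).1 h; omega
  have h : p ^ 2 % 24 = 1 % 24 := by
    have : p % 24 = 1 ∨ p % 24 = 5 ∨ p % 24 = 7 ∨ p % 24 = 11 ∨ p % 24 = 13 ∨ p % 24 = 17 ∨
      p % 24 = 19 ∨ p % 24 = 23 := by omega
    rw [Nat.pow_mod]
    rcases this with h | h | h | h | h | h | h | h <;> rw [h]
  exact_mod_cast (ZMod.natCast_eq_natCast_iff' _ _ _).2 h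

/-- Modulo `24`, the modular group is generated by `T` and the lower unitriangular matrix with
entry `p`, because `p ^ 2 ≡ 1`. -/
lemma exists_closure_map_eq {p : ℕ} (hp : p.Prime) (hp3 : 3 < p) (γ : SL(2, ℤ)) :
    ∃ t ∈ Subgroup.closure {ModularGroup.T, lowerUnipotent p},
      Matrix.SpecialLinearGroup.map (Int.castRingHom (ZMod 24)) t =
        Matrix.SpecialLinearGroup.map (Int.castRingHom (ZMod 24)) γ := by
  set φ := Matrix.SpecialLinearGroup.map (n := Fin 2) (Int.castRingHom (ZMod 24))
  set K := Subgroup.closure {ModularGroup.T, lowerUnipotent p}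
  have hT : ModularGroup.T ∈ K := Subgroup.subset_closure (by simp)
  have hU : lowerUnipotent p ∈ K := Subgroup.subset_closure (by simp)
  suffices h : (⊤ : Subgroup SL(2, ℤ)) ≤ (K.map φ).comap φ from h (Subgroup.mem_top γ)
  rw [← SpecialLinearGroup.SL2Z_generators, Subgroup.closure_le]
  rintro g (rfl | rfl)
  · refine ⟨ModularGroup.T⁻¹ * lowerUnipotent p ^ (p : ℤ) * ModularGroup.T⁻¹,
      mul_mem (mul_mem (inv_mem hT) (zpow_mem hU _)) (inv_mem hT), ?_⟩
    -- The generator `S` is `T⁻¹ V T⁻¹` with `V` lower unitriangular with entry `1 ≡ p ^ 2`.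
    have hS : ModularGroup.T⁻¹ * lowerUnipotent 1 * ModularGroup.T⁻¹ = ModularGroup.S := by
      rw [mul_inv_eq_iff_eq_mul, inv_mul_eq_iff_eq_mul]
      apply Subtype.ext
      simp [ModularGroup.coe_S, ModularGroup.coe_T, coe_lowerUnipotent]
    have hU1 : φ (lowerUnipotent p ^ (p : ℤ)) = φ (lowerUnipotent 1) := by
      have hp2 := sq_zmod_twentyfour_eq_one hp hp3
      rw [sq] at hp2
      rw [lowerUnipotent_zpow]
      ext i j
      fin_cases i <;> fin_cases j <;> simp [φ, coe_lowerUnipotent, hp2]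
    rw [← hS, map_mul, map_mul, map_mul, map_mul, hU1]
  · exact ⟨_, hT, rfl⟩

/-- On `Γ₁(p) ∩ Γ(24)` the multipliers of `η(z)` and `η(p z)` are the same sign, which enters
`r + s = 2 k` times in total. -/
lemma mem_slashStabilizer_of_mem_Gamma {p : ℕ} (hp : p.Prime) (hp3 : 3 < p) {r s k : ℤ}
    (hrs : r + s = 2 * k) {γ : SL(2, ℤ)} (hγ : γ ∈ CongruenceSubgroup.Gamma1 p)
    (hγ' : γ ∈ CongruenceSubgroup.Gamma 24) (hc : 0 ≤ γ 1 0) (hd : 0 < γ 1 1) :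
    γ ∈ slashStabilizer (etaPair p r s) k := by
  rw [mem_slashStabilizer_iff]
  intro z
  obtain ⟨ha1, hb1, hc1, hd1⟩ := CongruenceSubgroup.Gamma_mem.1 hγ'
  obtain ⟨-, hd1p, hc1p⟩ := (CongruenceSubgroup.Gamma1_mem p γ).1 hγ
  have hdet : γ 0 0 * γ 1 1 - γ 0 1 * γ 1 0 = 1 := by
    have := γ.det_coe; rwa [Matrix.det_fin_two] at this
  have hden : (γ 1 0 : ℂ) * z + γ 1 1 ≠ 0 := by
    rw [← ModularGroup.denom_apply]
    exact UpperHalfPlane.denom_ne_zero _ z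
  rw [etaPair, etaPair, coe_SL_smul]
  generalize γ 0 0 = a at *
  generalize γ 0 1 = b at *
  generalize γ 1 0 = c at *
  generalize γ 1 1 = d at *
  obtain ⟨c', rfl⟩ := (ZMod.intCast_zmod_eq_zero_iff_dvd _ _).1 hc1p
  have hp0 : (0 : ℤ) < p := by exact_mod_cast hp.pos
  lift c' to ℕ using nonneg_of_mul_nonneg_right hc hp0
  lift d to ℕ using hd.le
  replace hd : 0 < d := by exact_mod_cast hd
  have hp24 := sq_zmod_twentyfour_eq_one hp hp3
  have hc24 : (c' : ZMod 24) = 0 := by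
    have : (p : ZMod 24) * ((p : ZMod 24) * c') = 0 := by
      push_cast at hc1; rw [hc1, mul_zero]
    rwa [← mul_assoc, ← sq, hp24, one_mul] at this
  have hodd : Odd d := by
    have := congrArg (ZMod.castHom (by norm_num : 2 ∣ 24) (ZMod 2)) hd1
    rw [map_intCast, map_one, Int.cast_natCast] at this
    rwa [ZMod.natCast_eq_one_iff_odd] at this
  have hd4 : d % 4 = 1 := by
    have := (ZMod.natCast_eq_natCast_iff' d 1 24).1 (by simpa using hd1)
    omega
  have hpodd : Odd p := hp.odd_of_ne_two (by omega)
  -- By quadratic reciprocity `(p / d) = (d / p) = (1 / p) = 1`.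
  have hJp : J(p | d) = 1 := by
    rw [jacobiSym.quadratic_reciprocity_one_mod_four' hpodd hd4]
    rw [jacobiSym.mod_left' (a₂ := 1), jacobiSym.one_left]
    exact (ZMod.intCast_eq_intCast_iff' _ _ _).1 (by simpa using hd1p)
  have hdet' : a * d - p * b * c' = 1 := by linear_combination hdet
  have e1 := eta_smul_of_modEq_one (a := a) (b := b) (c := p * c') (d := d) hd
    (by push_cast; linear_combination hdet) ha1 hb1 (by push_cast; rw [hc24, mul_zero])
    (by simpa using hd1) z.im_pos
  have e2 := eta_smul_of_modEq_one (a := a) (b := p * b) (c := c') (d := d) hd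
    hdet' ha1 (by push_cast; rw [hb1, mul_zero]) hc24
    (by simpa using hd1) (natCast_mul_im_pos hp.pos z)
  rw [show J((p * c' : ℕ) | d) = J(c' | d) by
    rw [Nat.cast_mul, jacobiSym.mul_left, hJp, one_mul]] at e1
  push_cast at e1 e2 hden ⊢
  rw [show (c' : ℂ) * (p * z) + d = p * c' * z + d by ring,
    show (a : ℂ) * (p * z) + p * b = p * (a * z + b) by ring, ← mul_div_assoc'] at e2
  rw [e1, e2]
  set w : ℂ := p * c' * z + d with hw
  have hw0 : sqrt w ≠ 0 := sqrt_ne_zero' hden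
  have hj : ((J(c' | d) : ℤ) : ℂ) ^ (2 : ℤ) = 1 := by
    exact_mod_cast jacobiSym.sq_one (a := c') (b := d) (by simpa using coprime_of_det hdet')
  have hj0 : ((J(c' | d) : ℤ) : ℂ) ≠ 0 := fun h => by simp [h] at hj
  have hws : w ^ k = sqrt w ^ (r + s) := by
    rw [hrs, zpow_mul, zpow_ofNat, sqrt_sq_eq_self]
  have hjs : ((J(c' | d) : ℤ) : ℂ) ^ (r + s) = 1 := by
    rw [hrs, zpow_mul, hj, one_zpow]
  rw [hws]
  simp only [mul_zpow]
  rw [zpow_add₀ hw0]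
  rw [zpow_add₀ hj0] at hjs
  linear_combination (sqrt w ^ r * sqrt w ^ s * η z ^ r * η (p * z) ^ s) * hjs

theorem Gamma1_le_slashStabilizer {p : ℕ} (hp : p.Prime) (hp3 : 3 < p) {r s k : ℤ}
    (hrs : r + s = 2 * k) (h1 : (24 : ℤ) ∣ r + p * s) (h2 : (24 : ℤ) ∣ p * r + s) :
    CongruenceSubgroup.Gamma1 p ≤ slashStabilizer (etaPair p r s) k := by
  set H := slashStabilizer (etaPair p r s) k
  have hT : ModularGroup.T ∈ H := (T_mem_slashStabilizer_iff hp.pos).2 h1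
  have hU : lowerUnipotent p ∈ H := (lowerUnipotent_mem_slashStabilizer_iff hp.pos).2 ⟨hrs, h2⟩
  have hT1 : ModularGroup.T ∈ CongruenceSubgroup.Gamma1 p := by
    rw [CongruenceSubgroup.Gamma1_mem]; simp [ModularGroup.T]
  have hU1 : lowerUnipotent p ∈ CongruenceSubgroup.Gamma1 p := by
    rw [CongruenceSubgroup.Gamma1_mem]; simp [coe_lowerUnipotent]
  have hK : Subgroup.closure {ModularGroup.T, lowerUnipotent p} ≤
      H ⊓ CongruenceSubgroup.Gamma1 p := by
    rw [Subgroup.closure_le]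
    rintro g (rfl | rfl)
    · exact ⟨hT, hT1⟩
    · exact ⟨hU, hU1⟩
  have hT24 (m : ℤ) : ModularGroup.T ^ (24 * m) ∈ CongruenceSubgroup.Gamma 24 := by
    rw [CongruenceSubgroup.Gamma_mem]
    simp [ModularGroup.coe_T_zpow, show (24 : ZMod 24) = 0 from rfl]
  have hU24 (m : ℤ) : lowerUnipotent p ^ (24 * m) ∈ CongruenceSubgroup.Gamma 24 := by
    rw [CongruenceSubgroup.Gamma_mem, lowerUnipotent_zpow]
    simp [coe_lowerUnipotent, show (24 : ZMod 24) = 0 from rfl]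
  -- Right multiplication by powers of `T ^ 24` and of the lower unitriangular generator makes the
  -- lower row non-negative.
  have main (γ : SL(2, ℤ)) (hγ : γ ∈ CongruenceSubgroup.Gamma1 p)
      (hγ' : γ ∈ CongruenceSubgroup.Gamma 24) : γ ∈ H := by
    set t₁ := ModularGroup.T ^ (24 * (γ 1 0 * |γ 1 1|))
    set γ₁ := γ * t₁ with hγ₁
    set t₂ := lowerUnipotent p ^ (24 * |γ₁ 1 0|)
    set γ₂ := γ₁ * t₂ with hγ₂
    have hd0 : γ 1 1 ≠ 0 := fun h => by
      have := (CongruenceSubgroup.Gamma_mem.1 hγ').2.2.2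
      rw [h] at this
      exact absurd this (by decide)
    have h10 : γ₁ 1 0 = γ 1 0 := by
      simp [hγ₁, t₁, ModularGroup.coe_T_zpow, Matrix.mul_apply, Fin.sum_univ_two]
    have h11 : γ₁ 1 1 = γ 1 1 + 24 * (γ 1 0 ^ 2 * |γ 1 1|) := by
      simp [hγ₁, t₁, ModularGroup.coe_T_zpow, Matrix.mul_apply, Fin.sum_univ_two]
      ring
    have h20 : γ₂ 1 0 = γ₁ 1 0 + 24 * (|γ₁ 1 0| * p * γ₁ 1 1) := by
      simp [hγ₂, t₂, lowerUnipotent_zpow, coe_lowerUnipotent, Matrix.mul_apply, Fin.sum_univ_two]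
      ring
    have h21 : γ₂ 1 1 = γ₁ 1 1 := by
      simp [hγ₂, t₂, lowerUnipotent_zpow, coe_lowerUnipotent, Matrix.mul_apply, Fin.sum_univ_two]
    have hpos : 0 < γ₁ 1 1 := by
      rw [h11]
      rcases eq_or_ne (γ 1 0) 0 with hc | hc
      · have hdet : γ 0 0 * γ 1 1 - γ 0 1 * γ 1 0 = 1 := by
          have := γ.det_coe; rwa [Matrix.det_fin_two] at this
        rw [hc, mul_zero, sub_zero] at hdet
        rcases Int.isUnit_iff.1 (IsUnit.of_mul_eq_one_right _ hdet) with h | h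
        · rw [hc, h]; norm_num
        · have := (CongruenceSubgroup.Gamma_mem.1 hγ').2.2.2
          rw [h] at this
          exact absurd this (by decide)
      · have h1 : 1 ≤ γ 1 0 ^ 2 := by have := sq_pos_of_ne_zero hc; omega
        have h2 : 0 < |γ 1 1| := abs_pos.2 hd0
        nlinarith [neg_abs_le (γ 1 1)]
    have hnn : 0 ≤ γ₂ 1 0 := by
      rw [h20]
      have h1 : 0 ≤ |γ₁ 1 0| * ((p * γ₁ 1 1) - 1) := by
        refine mul_nonneg (abs_nonneg _) ?_
        have : (1 : ℤ) ≤ p := by exact_mod_cast hp.one_lt.le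
        nlinarith
      nlinarith [neg_abs_le (γ₁ 1 0), abs_nonneg (γ₁ 1 0)]
    have h : γ₂ ∈ H := mem_slashStabilizer_of_mem_Gamma hp hp3 hrs
      (mul_mem (mul_mem hγ (zpow_mem hT1 _)) (zpow_mem hU1 _))
      (mul_mem (mul_mem hγ' (hT24 _)) (hU24 _)) hnn (by rw [h21]; exact hpos)
    rwa [hγ₂, hγ₁, H.mul_mem_cancel_right (zpow_mem hU _),
      H.mul_mem_cancel_right (zpow_mem hT _)] at h
  intro γ hγ
  obtain ⟨t, ht, htγ⟩ := exists_closure_map_eq hp hp3 γ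
  obtain ⟨htH, ht1⟩ := hK ht
  have h24 : γ * t⁻¹ ∈ CongruenceSubgroup.Gamma 24 := by
    rw [CongruenceSubgroup.Gamma_mem', map_mul, map_inv, htγ, mul_inv_cancel]
  have := main _ (mul_mem hγ (inv_mem ht1)) h24
  rwa [H.mul_mem_cancel_right (inv_mem htH)] at this

end

/-! ### Growth at the cusps -/

noncomputable section

open ModularForm Complex
open scoped Real NumberTheorySymbols MatrixGroups Topology Manifold
open UpperHalfPlane hiding I
open Matrix.SpecialLinearGroup (mapGL)
open Filter

/-- Near `i∞`, `η` has the size of its leading factor `q ^ (1 / 24)`. -/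
lemma tendsto_norm_eta_mul_exp :
    Tendsto (fun w : ℂ => ‖η w‖ * Real.exp (2 * π * w.im / 24)) (comap im atTop) (𝓝 1) := by
  have h1 : Tendsto (fun q : ℂ => ∏' n : ℕ, (1 - q ^ (n + 1))) (𝓝 0) (𝓝 1) := by
    have := (differentiableOn_tprod_one_sub_pow.differentiableAt
      (Metric.isOpen_ball.mem_nhds (Metric.mem_ball_self one_pos))).continuousAt.tendsto
    simpa using this
  have h2 := (h1.mono_left nhdsWithin_le_nhds).comp (Function.Periodic.qParam_tendsto one_pos)
  refine (by simpa using h2.norm : Tendsto _ _ (𝓝 (1 : ℝ))).congr fun w => ?_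
  simp only [ModularForm.eta, eta_q, norm_mul,
    Function.Periodic.norm_qParam]
  rw [mul_right_comm, ← Real.exp_add]
  ring_nf
  simp

/-- The growth at `i∞` of a function which is comparable to a product of powers of `η` along
maps that scale imaginary parts by `α` and `β`. -/
lemma isZeroAtImInfty_iff_of_norm_eq {f : ℍ → ℂ} {u v : ℍ → ℂ} {α β C : ℝ} {r s : ℤ}
    (hα : 0 < α) (hβ : 0 < β) (hC : 0 < C) (hu : ∀ z, (u z).im = α * z.im)
    (hv : ∀ z, (v z).im = β * z.im) (hf : ∀ z, ‖f z‖ = C * (‖η (u z)‖ ^ r * ‖η (v z)‖ ^ s)) :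
    IsZeroAtImInfty f ↔ 0 < r * α + s * β := by
  have him : Tendsto UpperHalfPlane.im atImInfty atTop := tendsto_comap
  have hut : Tendsto u atImInfty (comap Complex.im atTop) := by
    rw [tendsto_comap_iff]
    exact (him.const_mul_atTop hα).congr fun z => (hu z).symm
  have hvt : Tendsto v atImInfty (comap Complex.im atTop) := by
    rw [tendsto_comap_iff]
    exact (him.const_mul_atTop hβ).congr fun z => (hv z).symm
  set κ : ℝ := 2 * π * (r * α + s * β) / 24 with hκ
  have hκpos : 0 < r * α + s * β ↔ 0 < κ := by
    rw [hκ]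
    have := Real.pi_pos
    constructor
    · intro h; positivity
    · intro h
      by_contra! h'
      have : 2 * π * (r * α + s * β) / 24 ≤ 0 := by
        have : 2 * π * (r * α + s * β) ≤ 0 := mul_nonpos_of_nonneg_of_nonpos (by positivity) h'
        linarith
      linarith
  have hlim : Tendsto (fun z : ℍ => ‖f z‖ * Real.exp (κ * z.im)) atImInfty (𝓝 C) := by
    have h1 := ((tendsto_norm_eta_mul_exp.comp hut).zpow₀ r (Or.inl one_ne_zero)).mul
      ((tendsto_norm_eta_mul_exp.comp hvt).zpow₀ s (Or.inl one_ne_zero))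
    have h2 := h1.const_mul C
    simp only [one_zpow, mul_one] at h2
    refine h2.congr fun z => ?_
    simp only [Function.comp_apply, hu, hv, hf, mul_zpow]
    rw [show κ * z.im = r * (2 * π * (α * z.im) / 24) + s * (2 * π * (β * z.im) / 24) by
      rw [hκ]; ring, Real.exp_add, mul_comm (r : ℝ), mul_comm (s : ℝ), Real.exp_mul, Real.exp_mul,
      Real.rpow_intCast, Real.rpow_intCast]
    ring
  rw [IsZeroAtImInfty, ZeroAtFilter, tendsto_zero_iff_norm_tendsto_zero, hκpos]
  constructor
  · intro h
    by_contra! hκ0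
    have hbd : Tendsto (fun z : ℍ => ‖f z‖ * Real.exp (κ * z.im)) atImInfty (𝓝 0) := by
      refine squeeze_zero (fun z => by positivity) (fun z => ?_) h
      refine mul_le_of_le_one_right (norm_nonneg _) (Real.exp_le_one_iff.2 ?_)
      exact mul_nonpos_of_nonpos_of_nonneg hκ0 z.im_pos.le
    exact hC.ne' (tendsto_nhds_unique hlim hbd)
  · intro hκ0
    have hexp : Tendsto (fun z : ℍ => Real.exp (-(κ * z.im))) atImInfty (𝓝 0) :=
      Real.tendsto_exp_neg_atTop_nhds_zero.comp (him.const_mul_atTop hκ0)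
    have := hlim.mul hexp
    rw [mul_zero] at this
    refine this.congr fun z => ?_
    rw [mul_assoc, ← Real.exp_add, add_neg_cancel, Real.exp_zero, mul_one]

/-- The absolute value of the transformation law of the discriminant, to the power `1 / 24`. -/
lemma norm_eta_SL_smul (γ : SL(2, ℤ)) (z : ℍ) :
    ‖η (γ • z : ℍ)‖ = √‖(γ 1 0 : ℂ) * z + γ 1 1‖ * ‖η z‖ := by
  have h : ModularForm.discriminant ∣[(12 : ℤ)] γ = ModularForm.discriminant :=
    SlashInvariantForm.slash_action_generators_SL2Z discriminant_S_invariant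
      discriminant_T_invariant γ
  have h2 := (slash_action_eq'_iff 12 ModularForm.discriminant γ z).1 (congrFun h z)
  have h3 := congrArg norm h2
  simp only [ModularForm.discriminant, norm_mul, norm_pow, norm_zpow] at h3
  refine (pow_left_inj₀ (norm_nonneg _) (by positivity) (by norm_num : 24 ≠ 0)).1 ?_
  rw [h3, mul_pow, show (24 : ℕ) = 2 * 12 from rfl, pow_mul (√_), Real.sq_sqrt (norm_nonneg _)]
  norm_cast

lemma norm_eta_moebius {a b c d : ℤ} (h : a * d - b * c = 1) {z : ℂ} (hz : 0 < z.im) :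
    ‖η ((a * z + b) / (c * z + d))‖ = √‖c * z + d‖ * ‖η z‖ := by
  let γ : SL(2, ℤ) := ⟨!![a, b; c, d], by rw [Matrix.det_fin_two_of, h]⟩
  have := norm_eta_SL_smul γ ⟨z, hz⟩
  rw [coe_SL_smul] at this
  simpa [γ] using this

/-- The matrices that are upper triangular modulo `p` preserve the absolute value, since
`p * (γ • z)` is a Möbius transform of `p z`. -/
lemma norm_etaPair_slash_of_dvd {p : ℕ} (hp : 0 < p) {r s k : ℤ} (hrs : r + s = 2 * k)
    {γ : SL(2, ℤ)} (hγ : (p : ℤ) ∣ γ 1 0) (z : ℍ) :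
    ‖(etaPair p r s ∣[k] γ) z‖ = ‖η z‖ ^ r * ‖η (p * z)‖ ^ s := by
  have hden : (γ 1 0 : ℂ) * z + γ 1 1 ≠ 0 := by
    rw [← ModularGroup.denom_apply]
    exact UpperHalfPlane.denom_ne_zero _ z
  have hdet : γ 0 0 * γ 1 1 - γ 0 1 * γ 1 0 = 1 := by
    have := γ.det_coe; rwa [Matrix.det_fin_two] at this
  rw [SL_slash_apply, ModularGroup.denom_apply, etaPair, coe_SL_smul]
  generalize γ 0 0 = a at *
  generalize γ 0 1 = b at *
  generalize γ 1 0 = c at *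
  generalize γ 1 1 = d at *
  obtain ⟨c', rfl⟩ := hγ
  have e1 := norm_eta_moebius hdet z.im_pos
  have e2 := norm_eta_moebius (a := a) (b := p * b) (c := c') (d := d)
    (by linear_combination hdet) (natCast_mul_im_pos hp z)
  push_cast at e1 e2 hden ⊢
  rw [show (c' : ℂ) * (p * z) + d = p * c' * z + d by ring,
    show (a : ℂ) * (p * z) + p * b = p * (a * z + b) by ring, ← mul_div_assoc'] at e2
  rw [norm_mul, norm_mul, norm_zpow, norm_zpow, norm_zpow, e1, e2, mul_zpow, mul_zpow]
  set w : ℝ := ‖(p : ℂ) * c' * z + d‖ with hw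
  have hw0 : 0 < w := norm_pos_iff.2 hden
  have hws : √w ^ r * √w ^ s = w ^ k := by
    rw [← zpow_add₀ (Real.sqrt_ne_zero'.2 hw0), hrs, zpow_mul, zpow_ofNat, Real.sq_sqrt hw0.le]
  have hwk : w ^ k * w ^ (-k) = 1 := by rw [← zpow_add₀ hw0.ne', add_neg_cancel, zpow_zero]
  linear_combination (‖η z‖ ^ r * ‖η (p * z)‖ ^ s * w ^ (-k)) * hws +
    (‖η z‖ ^ r * ‖η (p * z)‖ ^ s) * hwk

/-- The matrices that are not upper triangular modulo `p` all lead to the same growth, since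
`p * (γ • z)` is a Möbius transform of `(z + j) / p` for some integer `j`. -/
lemma norm_etaPair_slash_of_not_dvd {p : ℕ} (hp : p.Prime) {r s k : ℤ} (hrs : r + s = 2 * k)
    {γ : SL(2, ℤ)} (hγ : ¬ (p : ℤ) ∣ γ 1 0) : ∃ j : ℤ, ∀ z : ℍ,
    ‖(etaPair p r s ∣[k] γ) z‖ = (√p ^ s)⁻¹ * (‖η z‖ ^ r * ‖η ((z + j) / p)‖ ^ s) := by
  have hden (z : ℍ) : (γ 1 0 : ℂ) * z + γ 1 1 ≠ 0 := by
    rw [← ModularGroup.denom_apply]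
    exact UpperHalfPlane.denom_ne_zero _ z
  have hdet : γ 0 0 * γ 1 1 - γ 0 1 * γ 1 0 = 1 := by
    have := γ.det_coe; rwa [Matrix.det_fin_two] at this
  simp only [SL_slash_apply, ModularGroup.denom_apply, etaPair, coe_SL_smul]
  generalize γ 0 0 = a at *
  generalize γ 0 1 = b at *
  generalize γ 1 0 = c at *
  generalize γ 1 1 = d at *
  obtain ⟨x, y, hxy⟩ := ((Nat.prime_iff_prime_int.1 hp).coprime_iff_not_dvd.2 hγ : IsCoprime _ _)
  -- With `j ≡ d / c` modulo `p`, the entry `d - c j` is divisible by `p`.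
  have hj : d - c * (y * d) = p * (x * d) := by linear_combination (-d) * hxy
  refine ⟨y * d, fun z => ?_⟩
  generalize y * d = j at *
  generalize x * d = e at *
  have hp0 : (p : ℂ) ≠ 0 := by exact_mod_cast hp.ne_zero
  have hpR : (0 : ℝ) < p := by exact_mod_cast hp.pos
  have e1 := norm_eta_moebius hdet z.im_pos
  have him : 0 < (((z : ℂ) + j) / p).im := by
    have : (((z : ℂ) + j) / p).im = z.im / p := by
      rw [← ofReal_natCast, div_ofReal_im]; simp
    rw [this]
    exact div_pos z.im_pos hpR
  have e2 := norm_eta_moebius (a := p * a) (b := b - a * j) (c := c) (d := e)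
    (by linear_combination hdet - a * hj) him
  have hjC : (d : ℂ) - c * j = p * e := by exact_mod_cast congrArg (Int.cast (R := ℂ)) hj
  have e3 : (c : ℂ) * ((z + j) / p) + e = (c * z + d) / p := by
    field_simp
    linear_combination -hjC
  rw [e3] at e2
  push_cast at e2
  rw [show ((p : ℂ) * a * ((z + j) / p) + (b - a * j)) = a * z + b by field_simp; ring,
    div_div_eq_mul_div, mul_comm _ (p : ℂ), ← mul_div_assoc', norm_div, Complex.norm_natCast,
    Real.sqrt_div (norm_nonneg _)] at e2
  rw [norm_mul, norm_mul, norm_zpow, norm_zpow, norm_zpow, e1, e2, mul_zpow, mul_zpow, div_zpow]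
  set w : ℝ := ‖(c : ℂ) * z + d‖ with hw
  have hw0 : 0 < w := norm_pos_iff.2 (hden z)
  have hws : √w ^ r * √w ^ s = w ^ k := by
    rw [← zpow_add₀ (Real.sqrt_ne_zero'.2 hw0), hrs, zpow_mul, zpow_ofNat, Real.sq_sqrt hw0.le]
  have hwk : w ^ k * w ^ (-k) = 1 := by rw [← zpow_add₀ hw0.ne', add_neg_cancel, zpow_zero]
  linear_combination (‖η z‖ ^ r * ‖η ((z + j) / p)‖ ^ s * w ^ (-k) * (√p ^ s)⁻¹) * hws +
    (‖η z‖ ^ r * ‖η ((z + j) / p)‖ ^ s * (√p ^ s)⁻¹) * hwk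

lemma isZeroAtImInfty_etaPair_slash_iff_of_dvd {p : ℕ} (hp : 0 < p) {r s k : ℤ}
    (hrs : r + s = 2 * k) {γ : SL(2, ℤ)} (hγ : (p : ℤ) ∣ γ 1 0) :
    IsZeroAtImInfty (etaPair p r s ∣[k] γ) ↔ 0 < r + p * s := by
  rw [isZeroAtImInfty_iff_of_norm_eq (u := fun z => z) (v := fun z => p * z) (r := r) (s := s)
    (α := 1) (β := p) (C := 1)
    one_pos (Nat.cast_pos.2 hp) one_pos (fun z => by simp) (fun z => by simp)
    (fun z => by rw [norm_etaPair_slash_of_dvd hp hrs hγ z, one_mul])]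
  rw [mul_one, mul_comm]
  exact_mod_cast Iff.rfl

lemma isZeroAtImInfty_etaPair_slash_iff_of_not_dvd {p : ℕ} (hp : p.Prime) {r s k : ℤ}
    (hrs : r + s = 2 * k) {γ : SL(2, ℤ)} (hγ : ¬ (p : ℤ) ∣ γ 1 0) :
    IsZeroAtImInfty (etaPair p r s ∣[k] γ) ↔ 0 < p * r + s := by
  obtain ⟨j, hj⟩ := norm_etaPair_slash_of_not_dvd hp hrs hγ
  have hpR : (0 : ℝ) < p := by exact_mod_cast hp.pos
  rw [isZeroAtImInfty_iff_of_norm_eq (u := fun z => z) (v := fun z => (z + j) / p) (r := r)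
    (s := s) (α := 1) (β := (p : ℝ)⁻¹) (C := (√p ^ s)⁻¹)
    one_pos (by positivity) (by positivity) (fun z => by simp)
    (fun z => by rw [← ofReal_natCast, div_ofReal_im]; simp; ring) hj]
  rw [← mul_pos_iff_of_pos_left hpR, show (p : ℝ) * (r * 1 + s * (p : ℝ)⁻¹) = p * r + s by
    field_simp]
  exact_mod_cast Iff.rfl

/-- All cusps of `Γ₁(N)` are translates of `∞` under the modular group. -/
lemma isZeroAt_cusps_iff {N : ℕ} [NeZero N] {k : ℤ} {f : ℍ → ℂ} :
    (∀ {c : OnePoint ℝ}, IsCusp c ((CongruenceSubgroup.Gamma1 N).map (mapGL ℝ)) →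
      c.IsZeroAt f k) ↔ ∀ γ : SL(2, ℤ), IsZeroAtImInfty (f ∣[k] γ) := by
  constructor
  · intro h γ
    have hc : IsCusp (mapGL ℝ γ • OnePoint.infty) 𝒮ℒ := isCusp_SL2Z_iff'.2 ⟨γ, rfl⟩
    exact (OnePoint.isZeroAt_iff_forall_SL2Z hc).1
      (h ((Subgroup.IsArithmetic.isCusp_iff_isCusp_SL2Z _).2 hc)) γ rfl
  · intro h c hc
    rw [Subgroup.IsArithmetic.isCusp_iff_isCusp_SL2Z] at hc
    exact (OnePoint.isZeroAt_iff_forall_SL2Z hc).2 fun γ _ => h γ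

lemma mdifferentiable_etaPair {p : ℕ} (hp : 0 < p) (r s : ℤ) : MDiff (etaPair p r s) := by
  rw [UpperHalfPlane.mdifferentiable_iff]
  have h : DifferentiableOn ℂ (fun z : ℂ => η z ^ r * η (p * z) ^ s) {z | 0 < z.im} := by
    intro z hz
    have hz' := natCast_mul_im_pos hp ⟨z, hz⟩
    have h1 := differentiableAt_eta_of_mem_upperHalfPlaneSet hz
    have h2 : DifferentiableAt ℂ (fun z : ℂ => η (p * z)) z :=
      (differentiableAt_eta_of_mem_upperHalfPlaneSet hz').comp z (by fun_prop)
    exact ((h1.zpow (Or.inl (eta_ne_zero hz))).mul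
      (h2.zpow (Or.inl (eta_ne_zero hz')))).differentiableWithinAt
  refine h.congr fun z hz => ?_
  simp [etaPair, ofComplex_apply_of_im_pos hz]

/-- The conditions under which `η(z) ^ r * η(p z) ^ s` is a cusp form of weight `k` for `Γ₁(p)`:
the weight, integrality of the orders at the two cusps of `Γ₀(p)`, and their positivity. -/
structure IsCuspidalExponent (p : ℕ) (k r s : ℤ) : Prop where
  weight : r + s = 2 * k
  dvd_infty : (24 : ℤ) ∣ r + p * s
  dvd_zero : (24 : ℤ) ∣ p * r + s
  pos_infty : 0 < r + p * s
  pos_zero : 0 < p * r + s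

theorem exists_cuspForm_iff {p : ℕ} (hp : p.Prime) (hp3 : 3 < p) {k r s : ℤ} :
    (∃ f : CuspForm ((CongruenceSubgroup.Gamma1 p).map (mapGL ℝ)) k, ⇑f = etaPair p r s) ↔
      IsCuspidalExponent p k r s := by
  have : NeZero p := ⟨hp.ne_zero⟩
  constructor
  · rintro ⟨f, hf⟩
    have hstab : CongruenceSubgroup.Gamma1 p ≤ slashStabilizer (etaPair p r s) k := fun γ hγ => by
      have := SlashInvariantFormClass.slash_action_eq f (mapGL ℝ γ) ⟨γ, hγ, rfl⟩
      rw [hf] at this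
      exact this
    have hT := hstab (x := ModularGroup.T) (by
      rw [CongruenceSubgroup.Gamma1_mem]; simp [ModularGroup.T])
    have hU := hstab (x := lowerUnipotent p) (by
      rw [CongruenceSubgroup.Gamma1_mem]; simp [coe_lowerUnipotent])
    rw [T_mem_slashStabilizer_iff hp.pos] at hT
    rw [lowerUnipotent_mem_slashStabilizer_iff hp.pos] at hU
    have hz := isZeroAt_cusps_iff.1 (fun {c} hc => CuspFormClass.zero_at_cusps f hc)
    rw [hf] at hz
    refine ⟨hU.1, hT, hU.2, ?_, ?_⟩
    · exact (isZeroAtImInfty_etaPair_slash_iff_of_dvd hp.pos hU.1 (γ := 1) (by simp)).1 (hz 1)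
    · refine (isZeroAtImInfty_etaPair_slash_iff_of_not_dvd hp hU.1 (γ := ModularGroup.S) ?_).1
        (hz _)
      have : ¬ (p : ℤ) ∣ 1 := by exact_mod_cast hp.one_lt.ne' ∘ Nat.dvd_one.1
      simpa [ModularGroup.S] using this
  · rintro ⟨hw, h1, h2, h3, h4⟩
    refine ⟨⟨⟨etaPair p r s, ?_⟩, mdifferentiable_etaPair hp.pos r s, ?_⟩, rfl⟩
    · rintro _ ⟨γ, hγ, rfl⟩
      exact Gamma1_le_slashStabilizer hp hp3 hw h1 h2 hγ
    · refine isZeroAt_cusps_iff.2 fun γ => ?_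
      by_cases hγ : (p : ℤ) ∣ γ 1 0
      · exact (isZeroAtImInfty_etaPair_slash_iff_of_dvd hp.pos hw hγ).2 h3
      · exact (isZeroAtImInfty_etaPair_slash_iff_of_not_dvd hp hw hγ).2 h4

/-- The quotient of two eta-quotients of equal weight is `(η(p z) / η(z)) ^ m`, which tends to
zero at `i∞` if `m > 0`. -/
lemma etaPair_injective_of_weight_eq {p : ℕ} (hp : 1 < p) {r s r' s' : ℤ}
    (hw : r + s = r' + s') (h : etaPair p r s = etaPair p r' s') : s = s' := by
  have key {r s r' s' : ℤ} (hw : r + s = r' + s') (h : etaPair p r s = etaPair p r' s') :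
      s ≤ s' := by
    by_contra! hlt
    have hone : (fun _ : ℍ => (1 : ℂ)) = etaPair p (r - r') (s - s') := by
      ext z
      have h1 : η z ≠ 0 := eta_ne_zero z.im_pos
      have h2 : η (p * z) ≠ 0 := eta_ne_zero (natCast_mul_im_pos (by omega) z)
      have h3 := congrFun h z
      simp only [etaPair] at h3 ⊢
      rw [zpow_sub₀ h1, zpow_sub₀ h2, div_mul_div_comm, h3, div_self]
      exact mul_ne_zero (zpow_ne_zero _ h1) (zpow_ne_zero _ h2)
    have hzero : IsZeroAtImInfty (fun _ : ℍ => (1 : ℂ)) := by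
      rw [hone, isZeroAtImInfty_iff_of_norm_eq (u := fun z => z) (v := fun z => p * z)
        (r := r - r') (s := s - s') (α := 1) (β := p) (C := 1) one_pos (by positivity) one_pos
        (fun z => by simp) (fun z => by simp) (fun z => by simp [etaPair])]
      have : (0 : ℤ) < (r - r') * 1 + (s - s') * p := by
        have hp' : (1 : ℤ) < p := by exact_mod_cast hp
        nlinarith
      exact_mod_cast this
    exact one_ne_zero (tendsto_nhds_unique tendsto_const_nhds hzero)
  exact le_antisymm (key hw h) (key hw.symm h.symm)

end

/-! ### Counting -/

noncomputable section

open ModularForm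

/-- The complement `e = 12 / h` of the weight divisor `h`, together with the divisibility
`12 ∣ h (p + 1)` and the coprimality of `e` with `d = (p - 1) / (2 h)`. -/
lemma exists_etaWeightDivisor_cofactor {p d : ℕ} (hp : p.Prime) (hp3 : 3 < p)
    (hd : p - 1 = 2 * etaWeightDivisor p * d) :
    ∃ e g : ℕ, etaWeightDivisor p * e = 12 ∧ etaWeightDivisor p * (p + 1) = 12 * g ∧
      0 < g ∧ e.Coprime d := by
  have h2 : ¬ 2 ∣ p := fun h => by
    have := (Nat.prime_dvd_prime_iff_eq Nat.prime_two hp).1 h; omega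
  have h3 : ¬ 3 ∣ p := fun h => by
    have := (Nat.prime_dvd_prime_iff_eq Nat.prime_three hp).1 h; omega
  have hcop {e m r : ℕ} (hm : d % m = r) (he : e = m) (hr : r.Coprime m) : e.Coprime d := by
    rw [he, Nat.Coprime, Nat.gcd_rec, hm]; exact hr
  have hcases : p % 24 = 1 ∨ p % 24 = 5 ∨ p % 24 = 7 ∨ p % 24 = 11 ∨ p % 24 = 13 ∨ p % 24 = 17 ∨
      p % 24 = 19 ∨ p % 24 = 23 := by omega
  rcases hcases with h | h | h | h | h | h | h | h <;>
    simp only [etaWeightDivisor, h] at hd ⊢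
  · exact ⟨1, p + 1, by norm_num, by omega, by omega, Nat.coprime_one_left d⟩
  · exact ⟨6, (p + 1) / 6, by norm_num, by omega, by omega,
      hcop (r := 1) (by omega : d % 6 = 1) rfl (by norm_num)⟩
  · exact ⟨4, (p + 1) / 4, by norm_num, by omega, by omega,
      hcop (r := 1) (by omega : d % 4 = 1) rfl (by norm_num)⟩
  · exact ⟨12, (p + 1) / 12, by norm_num, by omega, by omega,
      hcop (r := 5) (by omega : d % 12 = 5) rfl (by norm_num)⟩
  · exact ⟨2, (p + 1) / 2, by norm_num, by omega, by omega,
      hcop (r := 1) (by omega : d % 2 = 1) rfl (by norm_num)⟩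
  · exact ⟨3, (p + 1) / 3, by norm_num, by omega, by omega,
      hcop (r := 2) (by omega : d % 3 = 2) rfl (by norm_num)⟩
  · exact ⟨4, (p + 1) / 4, by norm_num, by omega, by omega,
      hcop (r := 3) (by omega : d % 4 = 3) rfl (by norm_num)⟩
  · exact ⟨12, (p + 1) / 12, by norm_num, by omega, by omega,
      hcop (r := 11) (by omega : d % 12 = 11) rfl (by norm_num)⟩

/-- Cancelling a common factor of `n` and `e` does not affect divisibility by `d`, which is prime
to `e`. -/
lemma dvd_num_intCast_div_iff {d e : ℕ} (he : e ≠ 0) (hed : e.Coprime d) (n : ℤ) :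
    (d : ℤ) ∣ ((n : ℚ) / e).num ↔ (d : ℤ) ∣ n := by
  have hcop : IsCoprime (d : ℤ) e := Nat.isCoprime_iff_coprime.2 hed.symm
  have hden : ((n : ℚ) / e).den ∣ e := by
    have := Rat.den_dvd n e
    rw [Rat.divInt_eq_div] at this
    exact_mod_cast this
  have hcop' : IsCoprime (d : ℤ) ((n : ℚ) / e).den :=
    Nat.isCoprime_iff_coprime.2 (hed.symm.coprime_dvd_right hden)
  have heq : ((n : ℚ) / e).num * e = n * ((n : ℚ) / e).den := by
    have h1 := Rat.num_div_den ((n : ℚ) / e)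
    have h2 : (((n : ℚ) / e).den : ℚ) ≠ 0 := by exact_mod_cast ((n : ℚ) / e).den_ne_zero
    have he' : (e : ℚ) ≠ 0 := by exact_mod_cast he
    have : (((n : ℚ) / e).num : ℚ) * e = n * ((n : ℚ) / e).den := by
      field_simp at h1
      linear_combination h1
    exact_mod_cast this
  constructor
  · intro h
    exact hcop'.dvd_of_dvd_mul_right (heq ▸ h.mul_right _)
  · intro h
    exact hcop.dvd_of_dvd_mul_right (heq ▸ h.mul_right _)

lemma ratModEq_iff {d e h k' m : ℕ} (he : h * e = 12) (hed : e.Coprime d) :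
    RatModEq d (m : ℚ) ((k' : ℚ) * h / 12) ↔ (d : ℤ) ∣ e * m - k' := by
  have he0 : e ≠ 0 := by rintro rfl; omega
  have heq : (m : ℚ) - (k' : ℚ) * h / 12 = ((e * m - k' : ℤ) : ℚ) / e := by
    have h12 : (h : ℚ) * e = 12 := by exact_mod_cast he
    have he' : (e : ℚ) ≠ 0 := by exact_mod_cast he0
    push_cast
    field_simp
    linear_combination (-k' : ℚ) * h12
  rw [RatModEq, heq, dvd_num_intCast_div_iff he0 hed]

lemma etaQuotientCuspForms_image {p : ℕ} (hp : p.Prime) (hp3 : 3 < p) (k : ℤ) :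
    (fun f : CuspForm ((CongruenceSubgroup.Gamma1 p).map
      (Matrix.SpecialLinearGroup.mapGL ℝ)) k => (f : UpperHalfPlane → ℂ)) ''
        etaQuotientCuspForms p k =
      (fun s : ℤ => etaPair p (2 * k - s) s) '' {s | IsCuspidalExponent p k (2 * k - s) s} := by
  ext F
  constructor
  · rintro ⟨f, ⟨r, hr⟩, rfl⟩
    have hf : (f : UpperHalfPlane → ℂ) = etaPair p (r 1) (r p) := by
      rw [← etaQuotient_prime hp]; exact funext hr
    have h := (exists_cuspForm_iff hp hp3).1 ⟨f, hf⟩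
    have h1 : r 1 = 2 * k - r p := by linear_combination h.weight
    rw [h1] at h hf
    exact ⟨r p, h, hf.symm⟩
  · rintro ⟨s, hs, rfl⟩
    obtain ⟨f, hf⟩ := (exists_cuspForm_iff hp hp3).2 hs
    refine ⟨f, ⟨fun n => if n = 1 then 2 * k - s else s, fun z => ?_⟩, hf⟩
    rw [etaQuotient_prime hp, hf]
    simp [hp.one_lt.ne']

/-- The cusp forms that are eta-quotients are counted by the order of vanishing `x` at `i∞`:
it lies strictly between `0` and the total number of zeros `M`, and `e x ≡ k'` modulo `d`. -/
theorem etaQuotientCuspForms_finite_and_ncard {p k k' d e : ℕ} {M : ℤ} (hp : p.Prime)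
    (hp3 : 3 < p) (hk : k = etaWeightDivisor p * k') (hd : p - 1 = 2 * etaWeightDivisor p * d)
    (he : etaWeightDivisor p * e = 12) (hM : (k * (p + 1) : ℤ) = 12 * M) :
    (etaQuotientCuspForms p (k : ℤ)).Finite ∧ (etaQuotientCuspForms p (k : ℤ)).ncard =
      {x : ℤ | 0 < x ∧ x < M ∧ (d : ℤ) ∣ e * x - k'}.ncard := by
  set A : Set ℤ := {x : ℤ | 0 < x ∧ x < M ∧ (d : ℤ) ∣ e * x - k'}
  set B : Set ℤ := {s : ℤ | IsCuspidalExponent p k (2 * k - s) s}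
  have hd0 : d ≠ 0 := by rintro rfl; omega
  have he0 : e ≠ 0 := by rintro rfl; omega
  have hdZ : (d : ℤ) ≠ 0 := by exact_mod_cast hd0
  have heZ : (e : ℤ) ≠ 0 := by exact_mod_cast he0
  have hh0 : (etaWeightDivisor p : ℤ) ≠ 0 := by
    intro h; have : etaWeightDivisor p = 0 := by exact_mod_cast h
    rw [this] at he; omega
  have hpd : (p : ℤ) = 2 * etaWeightDivisor p * d + 1 := by
    have : p = 2 * etaWeightDivisor p * d + 1 := by omega
    exact_mod_cast this
  have hkZ : (k : ℤ) = etaWeightDivisor p * k' := by exact_mod_cast hk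
  have heh : (etaWeightDivisor p : ℤ) * e = 12 := by exact_mod_cast he
  -- The equation `e x = k' + d s` relates the order `x` at `i∞` to the exponent `s`; the order at
  -- the cusp `0` is then `M - x`.
  have hBA : (fun x : ℤ => (e * x - k') / d) '' A = B := by
    ext s
    constructor
    · rintro ⟨x, ⟨hx0, hxM, t, ht⟩, rfl⟩
      simp only [ht, Int.mul_ediv_cancel_left _ hdZ]
      have h1 : 2 * (k : ℤ) - t + p * t = 24 * x := by
        rw [hpd]
        linear_combination 2 * hkZ - 2 * (etaWeightDivisor p : ℤ) * ht + 2 * x * heh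
      have h2 : p * (2 * (k : ℤ) - t) + t = 24 * (M - x) := by linear_combination 2 * hM - h1
      exact ⟨by ring, ⟨x, h1⟩, ⟨M - x, h2⟩, by omega, by omega⟩
    · rintro ⟨-, ⟨x, hx⟩, -, h3, h4⟩
      have hx' : (e : ℤ) * x - k' = d * s := by
        have : 2 * (etaWeightDivisor p : ℤ) * (e * x - k') = 2 * etaWeightDivisor p * (d * s) := by
          rw [hpd] at hx
          linear_combination 2 * x * heh - hx + 2 * hkZ
        exact mul_left_cancel₀ (mul_ne_zero two_ne_zero hh0) this
      refine ⟨x, ⟨by omega, ?_, ⟨s, hx'⟩⟩, ?_⟩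
      · have : p * (2 * (k : ℤ) - s) + s = 24 * (M - x) := by linear_combination 2 * hM - hx
        omega
      · simp only [hx', Int.mul_ediv_cancel_left _ hdZ]
  have hinjA : Set.InjOn (fun x : ℤ => (e * x - k') / (d : ℤ)) A := by
    rintro x ⟨-, -, t, ht⟩ y ⟨-, -, u, hu⟩ hxy
    simp only [ht, hu, Int.mul_ediv_cancel_left _ hdZ] at hxy
    rw [hxy, ← hu] at ht
    exact mul_left_cancel₀ heZ (by linear_combination ht)
  have hinjB : Set.InjOn (fun s : ℤ => etaPair p (2 * (k : ℤ) - s) s) B := fun s _ t _ hst =>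
    etaPair_injective_of_weight_eq hp.one_lt (by ring) hst
  have hinj : Function.Injective (fun f : CuspForm ((CongruenceSubgroup.Gamma1 p).map
      (Matrix.SpecialLinearGroup.mapGL ℝ)) (k : ℤ) => (f : UpperHalfPlane → ℂ)) :=
    DFunLike.coe_injective
  have hAfin : A.Finite := (Set.finite_Ioo 0 M).subset fun x hx => ⟨hx.1, hx.2.1⟩
  have himg := etaQuotientCuspForms_image hp hp3 (k : ℤ)
  refine ⟨Set.Finite.of_finite_image ?_ hinj.injOn, ?_⟩
  · rw [himg]
    exact (hBA ▸ hAfin.image _).image _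
  · rw [← Set.ncard_image_of_injective _ hinj, himg, hinjB.ncard_image, ← hBA,
      hinjA.ncard_image]

/-- With `Q = ⌊M / d⌋`, the residue class of `c` has `Q + 1` or `Q` elements in `[0, M)`, one of
which is `0` if `c = 0`. -/
lemma ncard_residue_class_Ioo {d : ℕ} {c M Q : ℤ} (hc0 : 0 ≤ c) (hcd : c < d) (hM : 0 < M)
    (hQ : Q = M / d) :
    ({x : ℤ | 0 < x ∧ x < M ∧ x ≡ c [ZMOD d]}.ncard : ℤ) =
      (if c < M % d then Q + 1 else Q) - (if c = 0 then 1 else 0) := by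
  have hd : (0 : ℤ) < d := by omega
  have hset : {x : ℤ | 0 < x ∧ x < M ∧ x ≡ c [ZMOD d]} =
      (((Finset.Ico 1 M).filter (fun x => x ≡ c [ZMOD d]) : Finset ℤ) : Set ℤ) := by
    ext x
    rw [Finset.mem_coe, Finset.mem_filter, Finset.mem_Ico]
    exact ⟨fun ⟨h1, h2, h3⟩ => ⟨⟨h1, h2⟩, h3⟩, fun ⟨⟨h1, h2⟩, h3⟩ => ⟨h1, h2, h3⟩⟩
  rw [hset, Set.ncard_coe_finset, Int.Ico_filter_modEq_card _ _ hd]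
  have hdQ : (0 : ℚ) < ((d : ℤ) : ℚ) := by exact_mod_cast hd
  have hMQ : M = Q * d + M % d := by
    rw [hQ]; linarith [Int.ediv_mul_add_emod M d]
  have hR0 := Int.emod_nonneg M hd.ne'
  have hRd := Int.emod_lt_of_pos M hd
  have hQ0 : 0 ≤ Q := by rw [hQ]; exact Int.ediv_nonneg hM.le hd.le
  have h1 : ⌈((1 : ℤ) - (c : ℤ) : ℚ) / (d : ℤ)⌉ = if c = 0 then 1 else 0 := by
    rw [Int.ceil_eq_iff, lt_div_iff₀ hdQ, div_le_iff₀ hdQ]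
    split_ifs with h
    · have h1 : (1 : ℚ) ≤ d := by exact_mod_cast (by omega : (1 : ℤ) ≤ d)
      rw [h]; constructor <;> push_cast <;> linarith
    · have h1 : (1 : ℚ) ≤ c := by exact_mod_cast (by omega : (1 : ℤ) ≤ c)
      have h2 : (c : ℚ) < d := by exact_mod_cast hcd
      constructor <;> push_cast <;> linarith
  have h2 : ⌈((M : ℤ) - (c : ℤ) : ℚ) / (d : ℤ)⌉ = if c < M % d then Q + 1 else Q := by
    rw [Int.ceil_eq_iff, lt_div_iff₀ hdQ, div_le_iff₀ hdQ]
    split_ifs with h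
    · constructor <;> norm_cast <;> nlinarith
    · constructor <;> norm_cast <;> nlinarith
  rw [h1, h2]
  apply max_eq_left
  split_ifs with h3 h4 h4
  · omega
  · omega
  · have : Q ≠ 0 := by rintro rfl; omega
    omega
  · omega

end

theorem mainTheorem1 (p k k' d c : ℕ) (hp : p.Prime) (hp3 : 3 < p) (hk0 : 0 < k)
    (hk : k = etaWeightDivisor p * k')
    (hd : p - 1 = 2 * etaWeightDivisor p * d)
    (hc : IsLeast {m : ℕ | RatModEq d (m : ℚ) ((k' : ℚ) * (etaWeightDivisor p : ℚ) / 12)} c) :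
    (etaQuotientCuspForms p (k : ℤ)).Finite ∧
    ((c : ℚ) = (k : ℚ) * (p + 1) / 12 - ⌊(k : ℚ) * (p + 1) / (12 * d)⌋ * d →
      ((etaQuotientCuspForms p (k : ℤ)).ncard : ℚ) = (k : ℚ) * (p + 1) / (12 * d) - 1) ∧
    ((c : ℚ) < (k : ℚ) * (p + 1) / 12 - ⌊(k : ℚ) * (p + 1) / (12 * d)⌋ * d →
      ((etaQuotientCuspForms p (k : ℤ)).ncard : ℤ) = ⌈(k : ℚ) * (p + 1) / (12 * d)⌉) ∧
    ((c : ℚ) > (k : ℚ) * (p + 1) / 12 - ⌊(k : ℚ) * (p + 1) / (12 * d)⌋ * d →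
      ((etaQuotientCuspForms p (k : ℤ)).ncard : ℤ) = ⌊(k : ℚ) * (p + 1) / (12 * d)⌋) := by
  obtain ⟨e, g, he, hg, hg0, hed⟩ := exists_etaWeightDivisor_cofactor hp hp3 hd
  have hd0 : 0 < d := Nat.pos_of_ne_zero (by rintro rfl; omega)
  have hk'0 : 0 < k' := Nat.pos_of_ne_zero (by rintro rfl; simp at hk; omega)
  have hM : (k * (p + 1) : ℤ) = 12 * (k' * g : ℕ) := by
    have : k * (p + 1) = 12 * (k' * g) := by rw [hk]; linear_combination k' * hg
    exact_mod_cast this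
  set M : ℤ := ((k' * g : ℕ) : ℤ) with hMdef
  have hM0 : 0 < M := by rw [hMdef]; exact_mod_cast Nat.mul_pos hk'0 hg0
  obtain ⟨hfin, hcard⟩ := etaQuotientCuspForms_finite_and_ncard hp hp3 hk hd he hM
  simp only [ratModEq_iff he hed] at hc
  obtain ⟨hcmem, hcmin⟩ := hc
  replace hcmem : (d : ℤ) ∣ e * c - k' := hcmem
  have hedZ : IsCoprime (d : ℤ) e := Nat.isCoprime_iff_coprime.2 hed.symm
  have hcd : c < d := by
    refine (hcmin (?_ : (d : ℤ) ∣ e * (c % d : ℕ) - k')).trans_lt (Nat.mod_lt _ hd0)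
    have h1 : (d : ℤ) ∣ c - (c % d : ℕ) := by
      push_cast; exact Int.dvd_self_sub_emod
    have h2 := dvd_sub hcmem (h1.mul_left e)
    rwa [show (e : ℤ) * c - k' - e * (c - (c % d : ℕ)) = e * (c % d : ℕ) - k' by ring] at h2
  have hset : {x : ℤ | 0 < x ∧ x < M ∧ (d : ℤ) ∣ e * x - k'} =
      {x : ℤ | 0 < x ∧ x < M ∧ x ≡ c [ZMOD d]} := by
    ext x
    refine and_congr_right fun _ => and_congr_right fun _ => ?_
    rw [Int.modEq_comm, Int.modEq_iff_dvd]
    constructor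
    · intro h
      refine hedZ.dvd_of_dvd_mul_left ?_
      rw [show (e : ℤ) * (x - c) = e * x - k' - (e * c - k') by ring]
      exact dvd_sub h hcmem
    · intro h
      rw [show (e : ℤ) * x - k' = e * (x - c) + (e * c - k') by ring]
      exact dvd_add (h.mul_left _) hcmem
  rw [hset] at hcard
  have hcount := ncard_residue_class_Ioo (d := d) (c := c) (M := M) (by positivity)
    (by exact_mod_cast hcd) hM0 rfl
  rw [← hcard] at hcount
  have hdQ : (d : ℚ) ≠ 0 := by exact_mod_cast hd0.ne'
  have hMQ : (k : ℚ) * (p + 1) = 12 * M := by exact_mod_cast congrArg (Int.cast (R := ℚ)) hM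
  have e1 : (k : ℚ) * (p + 1) / 12 = M := by rw [hMQ]; ring
  have e2 : (k : ℚ) * (p + 1) / (12 * d) = M / d := by
    rw [hMQ, mul_div_mul_left _ _ (by norm_num)]
  have hfl : ⌊(M : ℚ) / d⌋ = M / d := by
    exact_mod_cast Rat.floor_intCast_div_natCast M d
  have hR : (M : ℚ) - (M / d : ℤ) * d = (M % d : ℤ) := by
    rw [Int.emod_def]; push_cast; ring
  rw [e1, e2, hfl, hR]
  have hMd := Int.ediv_mul_add_emod M d
  have hR0 := Int.emod_nonneg M (by omega : (d : ℤ) ≠ 0)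
  have hRd := Int.emod_lt_of_pos M (by omega : (0 : ℤ) < d)
  -- As `e c ≡ k'` and `e M ≡ 2 k'` modulo `d`, each of `c ≡ M` and `c ≡ 0` forces `d ∣ k'`.
  have heM : (d : ℤ) ∣ e * M - 2 * k' := by
    have hpZ : (p : ℤ) = 2 * etaWeightDivisor p * d + 1 := by
      have : p = 2 * etaWeightDivisor p * d + 1 := by omega
      exact_mod_cast this
    have heZ : (etaWeightDivisor p : ℤ) * e = 12 := by exact_mod_cast he
    have hkZ : (k : ℤ) = etaWeightDivisor p * k' := by exact_mod_cast hk
    have h12 : (12 : ℤ) * (e * M) = 12 * (k' * (p + 1)) := by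
      linear_combination -(e : ℤ) * hM + (e : ℤ) * (p + 1) * hkZ + k' * (p + 1) * heZ
    refine ⟨k' * (2 * etaWeightDivisor p), ?_⟩
    linear_combination mul_left_cancel₀ (by norm_num) h12 + k' * hpZ
  have hc_of_dvd (h : (d : ℤ) ∣ k') : c = 0 :=
    Nat.le_zero.1 (hcmin (show (d : ℤ) ∣ e * (0 : ℕ) - k' by simpa using h))
  have hM_of_dvd (h : (d : ℤ) ∣ k') : M % d = 0 := by
    refine Int.emod_eq_zero_of_dvd (hedZ.dvd_of_dvd_mul_left ?_)
    rw [show (e : ℤ) * M = e * M - 2 * k' + 2 * k' by ring]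
    exact dvd_add heM (h.mul_left _)
  have hc_ne_zero (h : M % d ≠ 0 ∨ c ≠ 0) : (c : ℤ) ≠ 0 := by
    intro hc0
    have hdk : (d : ℤ) ∣ k' := by simpa [hc0] using hcmem
    exact h.elim (fun h => h (hM_of_dvd hdk)) (fun h => h (hc_of_dvd hdk))
  refine ⟨hfin, fun h => ?_, fun h => ?_, fun h => ?_⟩
  · have hcR : (c : ℤ) = M % d := by exact_mod_cast h
    have hdk : (d : ℤ) ∣ k' := by
      have hdM : (d : ℤ) ∣ M - c := by rw [hcR]; exact Int.dvd_self_sub_emod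
      rw [show (k' : ℤ) = e * (M - c) + (e * c - k') - (e * M - 2 * k') by ring]
      exact dvd_sub (dvd_add (hdM.mul_left _) hcmem) heM
    have hR : M % d = 0 := hM_of_dvd hdk
    rw [hc_of_dvd hdk, hR] at hcount
    have hMd' : M = M / d * d := by omega
    have hMq : (M : ℚ) / d = (M / d : ℤ) := by
      rw [div_eq_iff hdQ]; exact_mod_cast hMd'
    rw [hMq]
    exact_mod_cast (by simpa using hcount : _ = M / (d : ℤ) - 1)
  · have hcR : (c : ℤ) < M % d := by exact_mod_cast h
    rw [if_pos hcR, if_neg (hc_ne_zero (Or.inl (by omega))), sub_zero] at hcount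
    rw [hcount, eq_comm, Int.ceil_eq_iff, lt_div_iff₀ (by positivity), div_le_iff₀ (by positivity)]
    constructor
    · have : (M / d + 1 - 1 : ℤ) * (d : ℤ) < M := by rw [add_sub_cancel_right]; omega
      exact_mod_cast this
    · have : M ≤ (M / d + 1 : ℤ) * (d : ℤ) := by rw [add_one_mul]; omega
      exact_mod_cast this
  · have hcR : M % d < (c : ℤ) := by exact_mod_cast h
    rw [hcount, if_neg hcR.le.not_gt, if_neg (hc_ne_zero (Or.inr (by omega))), sub_zero]
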